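/- **Setting.** Let $0<\epsilon\le 1$, $0<\delta\le 1$, $\alpha\in\mathbb N$. An instance is a finite set $I$ of items with sizes $s:I\to[\epsilon/14,1]$; $\mathrm{OPT}$ is the minimal number of unit bins that hold all items, and $\mathrm{SIZE}=\sum_i s(i)$. A rounding function $R$ maps every item to a group $(\ell,X,r)$ with $\ell,r\in\mathbb N$, $X\in\{A,B\}$. Let $q(\ell,X)$ be the largest $r$ for which $(\ell,X,r)$ is nonempty ($0$ if there is none), and $k=\lfloor \mathrm{SIZE}\cdot\epsilon/(2(\lfloor\log_2(1/\epsilon)\rfloor+5))\rfloor$. Assume that $R$ has these properties: (a) items in $(\ell,X,r)$ have size in $(2^{-(\ell+1)},2^{-\ell}]$; (b) if $r<r'$, no item of $(\ell,X,r')$ is larger than an item of $(\ell,X,r)$; (c) $|(\ell,A,r)|=2^\ell k$ for $1\le r\le q(\ell,A)$ and $|(\ell,A,0)|\le 2^\ell k$; (d) $|(\ell,B,r)|=2^\ell(k-1)$ for $0\le r<q(\ell,B)$ and $|(\ell,B,q(\ell,B))|\le 2^\ell(k-1)$. Round every item up to the largest size in its group ($s^R$). Let $m$ be the number of nonempty groups.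 A configuration is a vector of multiplicities, one per nonempty group, whose total rounded size is at most $1$. The configuration LP is $\min\{\|x\|_1: Ax\ge b,\ x\ge0\}$, where the columns of $A$ are the configurations and $b$ is the vector of group cardinalities; its value is $\mathrm{LIN}$. A packing $B:I\to\{1,\dots,\|y\|_1\}$ *corresponds* to an integral solution $y$ if each bin is given a configuration, configuration $c$ is given to exactly $y_c$ bins, and the items of each bin fit into the slots of its configuration. Put $\Delta=\epsilon+\delta+\epsilon\delta$, $C=\Delta\,\mathrm{OPT}+m$. **Algorithm IMPROVE($\alpha$)** on $x,y$. For $z\ge0$ let $V(z)$ be the set of integral $v$ with $0\le v\le z$. 1. $x^{var}=\frac{2\alpha(1/\delta+1)}{\|x\|_1}x$, $x^{fix}=x-x^{var}$, $b^{var}=b-Ax^{fix}$. 2. Compute $\hat x\ge0$ with $A\hat x\ge b^{var}$ and $\|\hat x\|_1\le(1+\delta/2)\min\{\|z\|_1:Az\ge b^{var},z\ge0\}$. 3. If $\|x^{fix}+\hat x\|_1\ge\|x\|_1$, set $x'=x$, $\hat y=y$ and go to 9. 4. List the nonzero components of $y$ in non-decreasing order; let $S$ be the set of the first $l$ of them,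 with $l$ largest such that $\sum_{i\in S}y_i\le(m+2)(1/\delta+2)$. 5. Let $\bar x^{fix},\bar y$ arise from $x^{fix},y$ by setting the components in $S$ to $0$. 6. Let $\bar x=\hat x+(x^{fix})|_S$, and reduce its support to a subset of at most $m+1$ components, keeping $\bar x\ge 0$, $A\bar x$ and $\|\bar x\|_1$. 7. $x'=\bar x^{fix}+\bar x$. 8. $\hat y_i=\max\{\lceil x'_i\rceil,\bar y_i\}$ for the nonzero components $i$ of $x'$, and $\hat y_i=0$ otherwise. 9. Choose $d\in V(\hat y-x')$ with $\|d\|_1=2\alpha(1/\delta+1)+(m+1)+\alpha$ if possible, otherwise with $\|d\|_1$ maximal below this number. 10. Return $x'$ and $y'=\hat y-d$. **Theorem.** There is an absolute constant $K$ such that the following holds. Let $x$ be a fractional solution of the LP with $\|x\|_1\le(1+\Delta)\mathrm{OPT}$, $\|x\|_1\ge2\alpha(1/\delta+1)$ and $\|x\|_1=(1+\delta')\mathrm{LIN}$ for some $\delta'>0$. Let $y$ be an integral solution with $\|y\|_1\ge(m+2)(1/\delta+2)$ and with a corresponding packing $B$ such that $\max_iB(i)=\|y\|_1\le(1+2\Delta)\mathrm{OPT}+m$.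 Suppose that $x$ and $y$ have the same number, at most $C$, of nonzero components and that $x_i\le y_i$ for all $i$. Then IMPROVE($\alpha$) on $x,y$ has an output, and for every output $(x',y')$, whatever the choices left open above: $x'$ is a fractional solution with $\|x'\|_1\le(1+\Delta)\mathrm{OPT}-\alpha$; $y'$ is an integral solution; $x'$ and $y'$ have the same number, at most $C$, of nonzero components; $x'_i\le y'_i$ for all $i$; and $y'$ has a corresponding packing $B'$ with $$\max_iB'(i)=\|y'\|_1\le(1+2\Delta)\mathrm{OPT}+m-\alpha$$ such that at most $K\frac{m+\alpha}{\delta}\le K(1+\alpha)\frac m\delta$ bins are changed, i.e. $O(m/\delta)$ bins for bounded $\alpha$. Here a bin number is *unchanged* if the bin exists in both packings with the same configuration and keeps all its items (it may receive further items in free slots of its configuration; a bin that fills its configuration and is unchanged has exactly the same contents). -/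

import Mathlib

noncomputable section

namespace DynamicBinPacking

/-! ### Bin packing -/

/-- `B` packs all items into the bins `1, …, k`, each of capacity `1`. -/
def IsPacking {I : Type*} [Fintype I] (s : I → ℝ) (k : ℕ) (B : I → ℕ) : Prop :=
  (∀ i, 1 ≤ B i ∧ B i ≤ k) ∧ ∀ j, ∑ i with B i = j, s i ≤ 1

/-- The minimal number of bins of a packing. -/
def opt {I : Type*} [Fintype I] (s : I → ℝ) : ℕ :=
  sInf {k | ∃ B, IsPacking s k B}

/-- The total size of all items. -/
def totalSize {I : Type*} [Fintype I] (s : I → ℝ) : ℝ := ∑ i, s i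

/-! ### Rounding functions -/

/-- The two blocks of groups in a size category. -/
inductive Block where
  | A : Block
  | B : Block
  deriving DecidableEq

/-- A group `(ℓ, X, r)`: size category, block, position in the block. -/
abbrev Group : Type := ℕ × Block × ℕ

/-- The set `g[R]` of the items that `R` maps to the group `g`. -/
def members {I : Type*} [Fintype I] (R : I → Group) (g : Group) : Finset I :=
  Finset.univ.filter fun i => R i = g

/-- `q(ℓ, X)`, the largest position of a nonempty group in block `X` of category `ℓ`
(and `0` if there is none). -/
def lastPos {I : Type*} [Fintype I] (R : I → Group) (l : ℕ) (X : Block) : ℕ :=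
  (Finset.univ.filter fun i => (R i).1 = l ∧ (R i).2.1 = X).sup fun i => (R i).2.2

/-- The properties (a) to (d) of a rounding function with parameter `k`. -/
structure IsRounding {I : Type*} [Fintype I] (s : I → ℝ) (k : ℕ) (R : I → Group) : Prop where
  category : ∀ l X r, ∀ i ∈ members R (l, X, r),
    (2 : ℝ)⁻¹ ^ (l + 1) < s i ∧ s i ≤ (2 : ℝ)⁻¹ ^ l
  sorted : ∀ l X r r', r < r' → ∀ i ∈ members R (l, X, r), ∀ i' ∈ members R (l, X, r'), s i' ≤ s i
  cardA : ∀ l r, 1 ≤ r → r ≤ lastPos R l Block.A →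
    (members R (l, Block.A, r)).card = 2 ^ l * k
  cardA_zero : ∀ l, (members R (l, Block.A, 0)).card ≤ 2 ^ l * k
  cardB : ∀ l r, r < lastPos R l Block.B →
    (members R (l, Block.B, r)).card = 2 ^ l * (k - 1)
  cardB_last : ∀ l, (members R (l, Block.B, lastPos R l Block.B)).card ≤ 2 ^ l * (k - 1)

/-- The group parameter `k = ⌊SIZE ε / (2 (⌊log₂ (1/ε)⌋ + 5))⌋`. -/
def groupParam {I : Type*} [Fintype I] (s : I → ℝ) (ε : ℝ) : ℕ :=
  ⌊totalSize s * ε / (2 * ((⌊Real.logb 2 (1 / ε)⌋ : ℝ) + 5))⌋₊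

/-- The nonempty groups of `R`; they index the constraints of the linear program. -/
abbrev Groups {I : Type*} [Fintype I] (R : I → Group) : Type :=
  {g : Group // g ∈ Finset.univ.image R}

/-- The number `m` of constraints. -/
def numGroups {I : Type*} [Fintype I] (R : I → Group) : ℕ := Fintype.card (Groups R)

theorem members_nonempty {I : Type*} [Fintype I] (R : I → Group) (g : Groups R) :
    (members R g.1).Nonempty := by
  obtain ⟨i, -, hi⟩ := Finset.mem_image.1 g.2
  exact ⟨i, by simp [members, hi]⟩

/-- The size of the largest item of a group. -/
def groupSize {I : Type*} [Fintype I] (s : I → ℝ) (R : I → Group) (g : Groups R) : ℝ :=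
  (members R g.1).sup' (members_nonempty R g) s

/-- The rounded size function `s^R`. -/
def roundedSize {I : Type*} [Fintype I] (s : I → ℝ) (R : I → Group) (i : I) : ℝ :=
  groupSize s R ⟨R i, Finset.mem_image_of_mem R (Finset.mem_univ i)⟩

/-! ### The configuration linear program of the rounded instance -/

/-- A vector of multiplicities, one for each nonempty group. -/
abbrev Column {I : Type*} [Fintype I] (R : I → Group) : Type := Groups R → ℕ

/-- A configuration: a multiset of rounded sizes that fits into one bin. -/
def IsConfig {I : Type*} [Fintype I] (s : I → ℝ) (R : I → Group) (c : Column R) : Prop :=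
  ∑ g, (c g : ℝ) * groupSize s R g ≤ 1

/-- The norm `‖x‖₁` of a real vector. -/
def norm₁ {ι : Type*} (x : ι →₀ ℝ) : ℝ := x.sum fun _ a => |a|

/-- The norm `‖y‖₁` of a vector of natural numbers. -/
def total {ι : Type*} (y : ι →₀ ℕ) : ℕ := y.sum fun _ n => n

/-- The product `A x`, where the columns of `A` are the configurations. -/
def cover {I : Type*} [Fintype I] {R : I → Group} (x : Column R →₀ ℝ) (g : Groups R) : ℝ :=
  x.sum fun c a => a * (c g : ℝ)

/-- The right-hand side of the linear program: the cardinalities of the groups. -/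
def rhs {I : Type*} [Fintype I] (R : I → Group) (g : Groups R) : ℝ := ((members R g.1).card : ℝ)

/-- `x` is a vector indexed by the configurations with `A x ≥ b` and `x ≥ 0`. (A vector is stored
as a finitely supported function on all columns that vanishes off the configurations; there are
only finitely many configurations when all sizes are positive.) -/
def IsFractional {I : Type*} [Fintype I] (s : I → ℝ) (R : I → Group) (b : Groups R → ℝ)
    (x : Column R →₀ ℝ) : Prop :=
  (∀ c, 0 ≤ x c) ∧ (∀ c ∈ x.support, IsConfig s R c) ∧ ∀ g, b g ≤ cover x g

/-- A vector of natural numbers, seen as a real vector. -/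
def toReal {ι : Type*} (y : ι →₀ ℕ) : ι →₀ ℝ := y.mapRange (fun n : ℕ => (n : ℝ)) Nat.cast_zero

/-- The optimal value of the linear program `min {‖x‖₁ : A x ≥ b, x ≥ 0}`. -/
def lin {I : Type*} [Fintype I] (s : I → ℝ) (R : I → Group) (b : Groups R → ℝ) : ℝ :=
  sInf {v | ∃ x, IsFractional s R b x ∧ norm₁ x = v}

/-! ### Packings that correspond to an integral solution -/

/-- The packing `B` into `‖y‖₁` bins corresponds to `y`: `conf j` is the configuration of bin `j`,
the configuration `c` is used by exactly `y c` bins, and the items in each bin occupy slots of its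
configuration. -/
structure Corresponds {I : Type*} [Fintype I] (s : I → ℝ) (R : I → Group) (y : Column R →₀ ℕ)
    (B : I → ℕ) (conf : ℕ → Column R) : Prop where
  packing : IsPacking (roundedSize s R) (total y) B
  count : ∀ c, ((Finset.Icc 1 (total y)).filter fun j => conf j = c).card = y c
  slots : ∀ j ∈ Finset.Icc 1 (total y), ∀ g : Groups R,
    ((members R g.1).filter fun i => B i = j).card ≤ conf j g

/-- The largest bin number in use. -/
def maxBin {I : Type*} [Fintype I] (B : I → ℕ) : ℕ := Finset.univ.sup B

open Classical in
/-- The bins that have to be changed to get from the packing `B` into `N` bins with configurations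
`conf` to the packing `B'` into `N'` bins with configurations `conf'`. A bin is unchanged if it
exists in both packings, has the same configuration in both, and keeps all its items. (It may
receive items in slots of its configuration that were free.) -/
def changedBins {I ι : Type*} [Fintype I] (N : ℕ) (B : I → ℕ) (conf : ℕ → ι)
    (N' : ℕ) (B' : I → ℕ) (conf' : ℕ → ι) : Finset ℕ :=
  (Finset.Icc 1 (max N N')).filter fun j =>
    ¬ (j ≤ N ∧ j ≤ N' ∧ conf' j = conf j ∧ ∀ i, B i = j → B' i = j)

/-! ### The algorithm Improve -/

/-- Step 1: the part of `x`, of norm `2 α (1/δ + 1)`, that is exchanged. -/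
def xVar {ι : Type*} (δ : ℝ) (α : ℕ) (x : ι →₀ ℝ) : ι →₀ ℝ :=
  (2 * (α * (1 / δ + 1)) / norm₁ x) • x

/-- Step 1: the part of `x` that is kept. -/
def xFix {ι : Type*} (δ : ℝ) (α : ℕ) (x : ι →₀ ℝ) : ι →₀ ℝ := x - xVar δ α x

/-- Step 1: the part of the right-hand side that `xFix` leaves uncovered. -/
def bVar {I : Type*} [Fintype I] {R : I → Group} (δ : ℝ) (α : ℕ) (x : Column R →₀ ℝ)
    (g : Groups R) : ℝ :=
  rhs R g - cover (xFix δ α x) g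

/-- Step 2: an approximate solution of the linear program with ratio `ρ`. -/
def IsApproxSolution {I : Type*} [Fintype I] (s : I → ℝ) (R : I → Group) (b : Groups R → ℝ)
    (ρ : ℝ) (x : Column R →₀ ℝ) : Prop :=
  IsFractional s R b x ∧ norm₁ x ≤ ρ * lin s R b

/-- The list `a` enumerates the nonzero components of `y` in non-decreasing order. -/
def IsSortedSupport {ι : Type*} (y : ι →₀ ℕ) (a : List ι) : Prop :=
  a.Nodup ∧ (∀ c, c ∈ a ↔ c ∈ y.support) ∧ a.Pairwise fun c c' => y c ≤ y c'

/-- Step 4: `l` is the largest number such that the `l` smallest nonzero components of `y` sum up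
to at most `t`. -/
def IsCutoff {ι : Type*} (y : ι →₀ ℕ) (a : List ι) (t : ℝ) (l : ℕ) : Prop :=
  IsGreatest {l | l ≤ a.length ∧ (((a.take l).map y).sum : ℝ) ≤ t} l

/-- Step 6: `z'` arises from `z` by reducing the number of nonzero components to at most `n`,
without changing the value, the covering `A z` or the sign. -/
def IsReduction {I : Type*} [Fintype I] {R : I → Group} (n : ℕ) (z z' : Column R →₀ ℝ) : Prop :=
  (∀ c, 0 ≤ z' c) ∧ z'.support ⊆ z.support ∧ z'.support.card ≤ n ∧
    cover z' = cover z ∧ norm₁ z' = norm₁ z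

open Classical in
/-- Step 8: `ŷ i = max {⌈x' i⌉, ȳ i}` for the nonzero components `i` of `x'`, and `0` elsewhere. -/
def roundUp {ι : Type*} (x' : ι →₀ ℝ) (ybar : ι →₀ ℕ) : ι →₀ ℕ :=
  Finsupp.zipWith (fun a n => if a = 0 then 0 else max ⌈a⌉₊ n) (by simp) x' ybar

/-- `d ∈ V(z)`: an integral vector with `0 ≤ d ≤ z`. -/
def InV {ι : Type*} (z : ι →₀ ℝ) (d : ι →₀ ℕ) : Prop := ∀ c, (d c : ℝ) ≤ z c

/-- Step 9: `d ∈ V(z)` has norm `t` if possible, and otherwise maximal norm below `t`. -/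
def IsRemoval {ι : Type*} (z : ι →₀ ℝ) (t : ℝ) (d : ι →₀ ℕ) : Prop :=
  InV z d ∧
    ((total d : ℝ) = t ∨
      ((¬ ∃ e, InV z e ∧ (total e : ℝ) = t) ∧ (total d : ℝ) < t ∧
        ∀ e, InV z e → (total e : ℝ) < t → total e ≤ total d))

/-- The amount that step 9 removes from `ŷ` if possible. The vector `ŷ` exceeds `y` in total by
less than `2 α (1/δ + 1)` (the bound for the exchanged part) plus `m + 1` (the components that are
rounded up), and `α` more bins are to be saved. -/
def removalAmount (m : ℕ) (δ : ℝ) (α : ℕ) : ℝ := 2 * (α * (1 / δ + 1)) + (m + 1) + α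

open Classical in
/-- Steps 4 to 8, for an approximate solution `xhat` of the exchanged part: `(x', ŷ)` is a possible
result of them. -/
def Exchange {I : Type*} [Fintype I] {R : I → Group} (δ : ℝ) (α : ℕ) (x : Column R →₀ ℝ)
    (y : Column R →₀ ℕ) (xhat x' : Column R →₀ ℝ) (yhat : Column R →₀ ℕ) : Prop :=
  ∃ (a : List (Column R)) (l : ℕ) (xbar : Column R →₀ ℝ),
    IsSortedSupport y a ∧
    IsCutoff y a ((numGroups R + 2) * (1 / δ + 2)) l ∧
    IsReduction (numGroups R + 1)
      (xhat + (xFix δ α x).filter fun c => c ∈ a.take l) xbar ∧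
    x' = (xFix δ α x).filter (fun c => c ∉ a.take l) + xbar ∧
    yhat = roundUp x' (y.filter fun c => c ∉ a.take l)

/-- `(x', y')` is a possible output of the algorithm Improve(α) on the input `x`, `y`. The
algorithm leaves some choices open: the approximate solution, the order of equal components, the
reduction and the removed vector. -/
def ImproveReturns {I : Type*} [Fintype I] (s : I → ℝ) (R : I → Group) (δ : ℝ) (α : ℕ)
    (x : Column R →₀ ℝ) (y : Column R →₀ ℕ) (x' : Column R →₀ ℝ) (y' : Column R →₀ ℕ) : Prop :=
  ∃ (xhat : Column R →₀ ℝ) (yhat d : Column R →₀ ℕ),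
    IsApproxSolution s R (bVar δ α x) (1 + δ / 2) xhat ∧
    ((norm₁ x ≤ norm₁ (xFix δ α x + xhat) ∧ x' = x ∧ yhat = y) ∨
      (norm₁ (xFix δ α x + xhat) < norm₁ x ∧ Exchange δ α x y xhat x' yhat)) ∧
    IsRemoval (toReal yhat - x') (removalAmount (numGroups R) δ α) d ∧
    y' = yhat - d

end DynamicBinPacking

end

/-!
Write `m` for the number of groups, `β = 2 α (1/δ + 1)` for the norm of the exchanged part of `x`,
and `LIN` for the value of the configuration program.

*The fractional solution.* Replacing each item of an optimal packing by an item of the next group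
of its block yields configurations that cover everything except one full group per block. A bin
holds `2 ^ l` rounded items of category `l`, so the rest costs at most `2 k` per category, and the
choice of `k` gives `LIN ≤ (1 + ε) OPT` (`lin_rhs_le`). Scaling a solution by `β / ‖x‖` covers what
`xFix` leaves uncovered, so the approximate solution `xhat` has norm at most
`(1 + δ/2) (β / ‖x‖) LIN`. Hence the new solution has norm at most
`max ‖x‖ ((1 + δ) LIN) - α` (`norm₁_xFix_add_le`), and both terms of the maximum are at most
`(1 + Δ) OPT`.

*The number of components.* The exchange drops the `l` smallest components of `y` and adds at most
`m + 1` new ones (Carathéodory's theorem, `exists_isReduction`). If `l ≤ m`, then the remaining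
components of `y` are all at least `1/δ + 2`, and the upper bound on `‖y‖` keeps their number
small (`IsCutoff.card_sub_le`).

*The integral solution.* Rounding up gives `‖ŷ‖ ≤ ‖y‖ + β + m + 1`
(`Exchange.isIntermediate`). The removal step takes away more than `β + m + α`, which saves `α`
bins by integrality, unless it leaves nothing but the components of `x'` rounded up; then the bounds
for `‖x'‖` and for the number of components add up to the claim (`IsIntermediate.total_sub_le`).

*The packing.* All items of a group are interchangeable, so any set of bins of the old packing that
uses no configuration more often than `y'` extends greedily to a packing for `y'`
(`exists_corresponds_extending`). Thus the number of changed bins is governed by `∑ (y - y')⁺`. Bins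
are given up only in the removal step and for the dropped components, `O((m + α) / δ)` in total. The
exception is `β = ‖x‖`, when all of `x` is exchanged and any bin may be lost; but then
`OPT ≤ ‖x‖ + m + 1` (`opt_le_norm₁_add`) shows that `y` itself has only `O((m + α) / δ)` bins.
-/

namespace DynamicBinPacking

/-! ### The configuration linear program -/

section Vectors
variable {ι : Type*}

theorem norm₁_nonneg (x : ι →₀ ℝ) : 0 ≤ norm₁ x :=
  Finset.sum_nonneg fun _ _ => abs_nonneg _

theorem norm₁_eq_linearCombination {x : ι →₀ ℝ} (hx : ∀ c, 0 ≤ x c) :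
    norm₁ x = Finsupp.linearCombination ℝ (fun _ => (1 : ℝ)) x := by
  rw [Finsupp.linearCombination_apply]
  exact Finset.sum_congr rfl fun c _ => by simp [abs_of_nonneg (hx c)]

theorem norm₁_add {x z : ι →₀ ℝ} (hx : ∀ c, 0 ≤ x c) (hz : ∀ c, 0 ≤ z c) :
    norm₁ (x + z) = norm₁ x + norm₁ z := by
  rw [norm₁_eq_linearCombination hx, norm₁_eq_linearCombination hz,
    norm₁_eq_linearCombination fun c => add_nonneg (hx c) (hz c), map_add]

theorem norm₁_smul {x : ι →₀ ℝ} {a : ℝ} (ha : 0 ≤ a) (hx : ∀ c, 0 ≤ x c) :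
    norm₁ (a • x) = a * norm₁ x := by
  rw [norm₁_eq_linearCombination hx,
    norm₁_eq_linearCombination fun c => mul_nonneg ha (hx c), map_smul, smul_eq_mul]

theorem norm₁_mono {x z : ι →₀ ℝ} (hx : ∀ c, 0 ≤ x c) (h : ∀ c, x c ≤ z c) :
    norm₁ x ≤ norm₁ z := by
  have hzx : ∀ c, 0 ≤ (z - x) c := fun c => sub_nonneg.2 (h c)
  have := norm₁_add hx hzx
  rw [add_sub_cancel] at this
  linarith [norm₁_nonneg (z - x)]

theorem eq_zero_of_norm₁_eq_zero {x : ι →₀ ℝ} (h : norm₁ x = 0) : x = 0 := by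
  ext c
  by_contra hc
  have := (Finset.sum_eq_zero_iff_of_nonneg fun c _ => abs_nonneg (x c)).1 h c
    (Finsupp.mem_support_iff.2 hc)
  exact hc (abs_eq_zero.1 this)

@[simp] theorem toReal_apply (y : ι →₀ ℕ) (c : ι) : toReal y c = y c := rfl

theorem toReal_nonneg (y : ι →₀ ℕ) (c : ι) : 0 ≤ toReal y c := Nat.cast_nonneg _

theorem norm₁_toReal (y : ι →₀ ℕ) : norm₁ (toReal y) = total y := by
  unfold norm₁ toReal total
  rw [Finsupp.sum_mapRange_index (by simp)]
  simp [Finsupp.sum]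

@[simp] theorem support_toReal (y : ι →₀ ℕ) : (toReal y).support = y.support := by
  ext c
  simp

theorem total_add (y z : ι →₀ ℕ) : total (y + z) = total y + total z :=
  Finsupp.sum_add_index' (fun _ => rfl) fun _ _ _ => rfl

theorem total_mono {y z : ι →₀ ℕ} (h : y ≤ z) : total y ≤ total z := by
  obtain ⟨w, rfl⟩ := exists_add_of_le h
  simp [total_add]

theorem total_eq_sum {y : ι →₀ ℕ} {T : Finset ι} (h : y.support ⊆ T) : total y = ∑ c ∈ T, y c :=
  Finsupp.sum_of_support_subset _ h _ fun _ _ => rfl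

end Vectors

variable {I : Type*} [Fintype I] {s : I → ℝ} {R : I → Group}

theorem cover_eq_linearCombination (x : Column R →₀ ℝ) (g : Groups R) :
    cover x g = Finsupp.linearCombination ℝ (fun c : Column R => (c g : ℝ)) x := by
  simp [cover, Finsupp.linearCombination_apply]

theorem cover_add (x z : Column R →₀ ℝ) (g : Groups R) :
    cover (x + z) g = cover x g + cover z g := by
  simp only [cover_eq_linearCombination, map_add]

theorem cover_smul (a : ℝ) (x : Column R →₀ ℝ) (g : Groups R) :
    cover (a • x) g = a * cover x g := by
  simp only [cover_eq_linearCombination, map_smul, smul_eq_mul]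

theorem cover_zero (g : Groups R) : cover (0 : Column R →₀ ℝ) g = 0 := by
  simp [cover]

theorem cover_nonneg {x : Column R →₀ ℝ} (hx : ∀ c, 0 ≤ x c) (g : Groups R) : 0 ≤ cover x g :=
  Finset.sum_nonneg fun c _ => mul_nonneg (hx c) (Nat.cast_nonneg _)

theorem cover_mono {x z : Column R →₀ ℝ} (h : ∀ c, x c ≤ z c) (g : Groups R) :
    cover x g ≤ cover z g := by
  have hzx : ∀ c, 0 ≤ (z - x) c := fun c => sub_nonneg.2 (h c)
  have := cover_add x (z - x) g
  rw [add_sub_cancel] at this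
  linarith [cover_nonneg hzx g]

theorem IsFractional.add {b b' : Groups R → ℝ} {x z : Column R →₀ ℝ}
    (hx : IsFractional s R b x) (hz : IsFractional s R b' z) :
    IsFractional s R (fun g => b g + b' g) (x + z) := by
  classical
  refine ⟨fun c => add_nonneg (hx.1 c) (hz.1 c), fun c hc => ?_, fun g => ?_⟩
  · rcases Finset.mem_union.1 (Finsupp.support_add hc) with h | h
    exacts [hx.2.1 c h, hz.2.1 c h]
  · rw [cover_add]
    exact add_le_add (hx.2.2 g) (hz.2.2 g)

theorem IsFractional.mono {b b' : Groups R → ℝ} {x : Column R →₀ ℝ}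
    (hx : IsFractional s R b x) (h : ∀ g, b' g ≤ b g) : IsFractional s R b' x :=
  ⟨hx.1, hx.2.1, fun g => (h g).trans (hx.2.2 g)⟩

theorem IsFractional.smul {b : Groups R → ℝ} {x : Column R →₀ ℝ} {a : ℝ} (ha : 0 ≤ a)
    (hx : IsFractional s R b x) : IsFractional s R (fun g => a * b g) (a • x) :=
  ⟨fun c => mul_nonneg ha (hx.1 c), fun c hc => hx.2.1 c (Finsupp.support_smul hc), fun g => by
    rw [cover_smul]; exact mul_le_mul_of_nonneg_left (hx.2.2 g) ha⟩

theorem bddBelow_values (b : Groups R → ℝ) :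
    BddBelow {v | ∃ x, IsFractional s R b x ∧ norm₁ x = v} :=
  ⟨0, by rintro _ ⟨x, -, rfl⟩; exact norm₁_nonneg x⟩

theorem lin_le {b : Groups R → ℝ} {x : Column R →₀ ℝ} (hx : IsFractional s R b x) :
    lin s R b ≤ norm₁ x :=
  csInf_le (bddBelow_values b) ⟨x, hx, rfl⟩

theorem le_lin {b : Groups R → ℝ} {v : ℝ} (hne : ∃ x, IsFractional s R b x)
    (h : ∀ x, IsFractional s R b x → v ≤ norm₁ x) : v ≤ lin s R b := by
  obtain ⟨x, hx⟩ := hne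
  exact le_csInf ⟨_, x, hx, rfl⟩ (by rintro _ ⟨z, hz, rfl⟩; exact h z hz)

theorem groupSize_pos (hs : ∀ i, 0 < s i) (g : Groups R) : 0 < groupSize s R g := by
  obtain ⟨i, hi⟩ := members_nonempty R g
  exact (hs i).trans_le (Finset.le_sup' s hi)

/-- A configuration has at most `1 / groupSize` slots for a group, so a vector of small norm
covers little. -/
theorem cover_mul_groupSize_le (hs : ∀ i, 0 < s i) {b : Groups R → ℝ} {x : Column R →₀ ℝ}
    (hx : IsFractional s R b x) (g : Groups R) : cover x g * groupSize s R g ≤ norm₁ x := by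
  rw [cover, Finsupp.sum, Finset.sum_mul]
  refine Finset.sum_le_sum fun c hc => ?_
  have h1 : (c g : ℝ) * groupSize s R g ≤ 1 :=
    (Finset.single_le_sum (f := fun g => (c g : ℝ) * groupSize s R g)
      (fun g _ => mul_nonneg (Nat.cast_nonneg _) (groupSize_pos hs g).le)
      (Finset.mem_univ g)).trans (hx.2.1 c hc)
  rw [mul_assoc]
  exact (mul_le_of_le_one_right (hx.1 c) h1).trans (le_abs_self _)

/-- Approximate solutions exist for every ratio above `1`: if the optimal value is `0`, then the
right-hand side is nonpositive and the zero vector is a solution. -/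
theorem exists_isApproxSolution (hs : ∀ i, 0 < s i) {b : Groups R → ℝ} {ρ : ℝ} (hρ : 1 < ρ)
    (hne : ∃ x, IsFractional s R b x) : ∃ x, IsApproxSolution s R b ρ x := by
  rcases lt_or_ge 0 (lin s R b) with h | h
  · obtain ⟨x, hx⟩ := hne
    obtain ⟨_, ⟨z, hz, rfl⟩, hlt⟩ := exists_lt_of_csInf_lt
      (s := {v | ∃ x, IsFractional s R b x ∧ norm₁ x = v}) ⟨_, x, hx, rfl⟩
      (show lin s R b < ρ * lin s R b by nlinarith)
    exact ⟨z, hz, hlt.le⟩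
  · have h0 : lin s R b = 0 := h.antisymm (le_lin hne fun x _ => norm₁_nonneg x)
    refine ⟨0, ⟨by simp, by simp, fun g => ?_⟩, by simp [h0, norm₁]⟩
    have hle : b g * groupSize s R g ≤ lin s R b := le_lin hne fun x hx =>
      (mul_le_mul_of_nonneg_right (hx.2.2 g) (groupSize_pos hs g).le).trans
        (cover_mul_groupSize_le hs hx g)
    rw [cover_zero]
    by_contra hb
    have := mul_pos (not_le.1 hb) (groupSize_pos hs g)
    linarith

/-- Up to scaling, `A z` is a convex combination of the columns in the support of `z`, so
Carathéodory's theorem in dimension `numGroups R` applies. -/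
theorem exists_isReduction {z : Column R →₀ ℝ} (hz : ∀ c, 0 ≤ z c) :
    ∃ z', IsReduction (numGroups R + 1) z z' := by
  classical
  rcases (norm₁_nonneg z).eq_or_lt with h0 | hN
  · rw [eq_zero_of_norm₁_eq_zero h0.symm]
    exact ⟨0, by simp, subset_rfl, by simp, rfl, rfl⟩
  set N := norm₁ z with hNdef
  let v : Column R → Groups R → ℝ := fun c g => c g
  have hsum : ∑ c ∈ z.support, z c / N = 1 := by
    rw [← Finset.sum_div, div_eq_one_iff_eq hN.ne', hNdef, norm₁, Finsupp.sum]
    exact Finset.sum_congr rfl fun c _ => (abs_of_nonneg (hz c)).symm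
  have hmem : ∑ c ∈ z.support, (z c / N) • v c ∈ convexHull ℝ (v '' z.support) :=
    (convex_convexHull ℝ _).sum_mem (fun c _ => div_nonneg (hz c) hN.le) hsum
      fun c hc => subset_convexHull ℝ _ ⟨c, hc, rfl⟩
  obtain ⟨κ, _, p, w, hp, haff, hw, hw1, hwp⟩ := eq_pos_convex_span_of_mem_convexHull hmem
  choose col hcol using fun i => hp ⟨i, rfl⟩
  have hcard : Fintype.card κ ≤ numGroups R + 1 :=
    haff.card_le_finrank_succ.trans (Nat.succ_le_succ
      ((Submodule.finrank_le _).trans (by simp [numGroups])))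
  set z' : Column R →₀ ℝ := N • ∑ i, Finsupp.single (col i) (w i) with hz'
  have hz'0 : ∀ c, 0 ≤ z' c := fun c => by
    simp only [hz', Finsupp.smul_apply, Finsupp.finsetSum_apply, smul_eq_mul]
    refine mul_nonneg hN.le (Finset.sum_nonneg fun i _ => ?_)
    rw [Finsupp.single_apply]
    split_ifs
    exacts [(hw i).le, le_rfl]
  have hsupp : z'.support ⊆ Finset.univ.image col := by
    refine Finsupp.support_smul.trans (Finsupp.support_finsetSum.trans fun c hc => ?_)
    obtain ⟨i, -, hi⟩ := Finset.mem_biUnion.1 hc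
    have := Finsupp.support_single_subset hi
    exact Finset.mem_image.2 ⟨i, Finset.mem_univ i, (Finset.mem_singleton.1 this).symm⟩
  refine ⟨z', hz'0, fun c hc => ?_,
    (Finset.card_le_card hsupp).trans (Finset.card_image_le.trans (by simpa using hcard)), ?_, ?_⟩
  · obtain ⟨i, -, rfl⟩ := Finset.mem_image.1 (hsupp hc)
    exact (hcol i).1
  · funext g
    have h1 := congrFun hwp g
    simp only [Finset.sum_apply, Pi.smul_apply, smul_eq_mul] at h1
    have h2 : ∀ i, (col i g : ℝ) = p i g := fun i => congrFun (hcol i).2 g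
    rw [hz', cover_smul, cover_eq_linearCombination, map_sum]
    simp only [Finsupp.linearCombination_single, smul_eq_mul, h2]
    rw [h1, Finset.mul_sum, cover, Finsupp.sum]
    refine Finset.sum_congr rfl fun c _ => ?_
    simp only [v]
    field_simp
  · rw [norm₁_eq_linearCombination hz'0, hz', map_smul, map_sum]
    simp [hw1, hNdef]

/-! ### Rounding costs at most a factor `1 + ε` -/

theorem exists_isPacking_opt (hs1 : ∀ i, s i ≤ 1) : ∃ B, IsPacking s (opt s) B := by
  classical
  refine Nat.sInf_mem (s := {k | ∃ B, IsPacking s k B})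
    ⟨Fintype.card I, fun i => Fintype.equivFin I i + 1, fun i =>
      ⟨Nat.le_add_left _ _, (Fintype.equivFin I i).2⟩, fun j => ?_⟩
  have hcard : (Finset.univ.filter fun i => (Fintype.equivFin I i : ℕ) + 1 = j).card ≤ 1 := by
    refine Finset.card_le_one.2 fun a ha b hb => ?_
    simp only [Finset.mem_filter, Finset.mem_univ, true_and] at ha hb
    exact (Fintype.equivFin I).injective (Fin.ext (by omega))
  calc _ ≤ ∑ i with (Fintype.equivFin I i : ℕ) + 1 = j, (1 : ℝ) :=
        Finset.sum_le_sum fun i _ => hs1 i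
    _ ≤ 1 := by simpa using hcard

theorem totalSize_le_of_isPacking {k : ℕ} {B : I → ℕ} (h : IsPacking s k B) :
    totalSize s ≤ k := by
  have hmaps : ∀ i ∈ (Finset.univ : Finset I), B i ∈ Finset.Icc 1 k := fun i _ =>
    Finset.mem_Icc.2 (h.1 i)
  rw [totalSize, ← Finset.sum_fiberwise_of_maps_to hmaps]
  calc _ ≤ ∑ j ∈ Finset.Icc 1 k, (1 : ℝ) := Finset.sum_le_sum fun j _ => h.2 j
    _ = k := by simp

/-- The items of the preceding group in the same block; none for the first group of a block. -/
def prevMembers (R : I → Group) : Group → Finset I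
  | (_, _, 0) => ∅
  | (l, X, r + 1) => members R (l, X, r)

theorem groupSize_le_of_mem_prevMembers {k : ℕ} (hR : IsRounding s k R) (g : Groups R) {i : I}
    (hi : i ∈ prevMembers R g.1) : groupSize s R g ≤ s i := by
  obtain ⟨⟨l, X, r⟩, hg⟩ := g
  refine Finset.sup'_le _ _ fun i' hi' => ?_
  cases r with
  | zero => simp [prevMembers] at hi
  | succ r => exact hR.sorted l X r (r + 1) (Nat.lt_succ_self r) i hi i' hi'

theorem disjoint_prevMembers {g g' : Group} (h : g ≠ g') :
    Disjoint (prevMembers R g) (prevMembers R g') := by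
  refine Finset.disjoint_left.2 fun i hi hi' => h ?_
  obtain ⟨l, X, r⟩ := g
  obtain ⟨l', X', r'⟩ := g'
  cases r <;> cases r' <;> simp_all [prevMembers, members]

/-- The configuration that arises from the bin `j` of the packing `B` if each of its items is
replaced by an item of the next group. The replacing items are not larger even after rounding. -/
def shiftedColumn (R : I → Group) (B : I → ℕ) (j : ℕ) : Column R := fun g =>
  ((prevMembers R g.1).filter fun i => B i = j).card

theorem isConfig_shiftedColumn {k n : ℕ} (hR : IsRounding s k R) {B : I → ℕ}
    (hs : ∀ i, 0 < s i) (hB : IsPacking s n B) (j : ℕ) : IsConfig s R (shiftedColumn R B j) := by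
  classical
  calc ∑ g, (shiftedColumn R B j g : ℝ) * groupSize s R g
      ≤ ∑ g : Groups R, ∑ i ∈ (prevMembers R g.1).filter fun i => B i = j, s i := by
        refine Finset.sum_le_sum fun g _ => ?_
        rw [shiftedColumn, ← nsmul_eq_mul]
        exact Finset.card_nsmul_le_sum _ _ _ fun i hi =>
          groupSize_le_of_mem_prevMembers hR g (Finset.mem_filter.1 hi).1
    _ = ∑ i ∈ Finset.univ.biUnion fun g : Groups R =>
          (prevMembers R g.1).filter fun i => B i = j, s i := by
        refine (Finset.sum_biUnion fun g _ g' _ hgg' => ?_).symm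
        exact (disjoint_prevMembers fun h => hgg' (Subtype.ext h)).mono
          (Finset.filter_subset _ _) (Finset.filter_subset _ _)
    _ ≤ ∑ i with B i = j, s i := by
        refine Finset.sum_le_sum_of_subset_of_nonneg (fun i hi => ?_) fun i _ _ => (hs i).le
        obtain ⟨g, -, hg⟩ := Finset.mem_biUnion.1 hi
        simpa using (Finset.mem_filter.1 hg).2
    _ ≤ 1 := hB.2 j

/-- A packing of the original items covers in each group as many rounded items as the preceding
group has. -/
theorem exists_isFractional_prevMembers {k n : ℕ} (hR : IsRounding s k R) {B : I → ℕ}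
    (hs : ∀ i, 0 < s i) (hB : IsPacking s n B) :
    ∃ x, IsFractional s R (fun g => ((prevMembers R g.1).card : ℝ)) x ∧ norm₁ x = n := by
  classical
  set x : Column R →₀ ℝ := ∑ j ∈ Finset.Icc 1 n, Finsupp.single (shiftedColumn R B j) 1
  have hx0 : ∀ c, 0 ≤ x c := fun c => by
    simp only [x, Finsupp.finsetSum_apply]
    refine Finset.sum_nonneg fun j _ => ?_
    rw [Finsupp.single_apply]
    split_ifs <;> norm_num
  refine ⟨x, ⟨hx0, fun c hc => ?_, fun g => ?_⟩, ?_⟩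
  · obtain ⟨j, -, hj⟩ := Finset.mem_biUnion.1 (Finsupp.support_finsetSum hc)
    rw [Finset.mem_singleton.1 (Finsupp.support_single_subset hj)]
    exact isConfig_shiftedColumn hR hs hB j
  · rw [cover_eq_linearCombination, map_sum]
    simp only [Finsupp.linearCombination_single, one_smul, shiftedColumn]
    rw [← Nat.cast_sum, ← Finset.card_eq_sum_card_fiberwise fun i _ => Finset.mem_Icc.2 (hB.1 i)]
  · rw [norm₁_eq_linearCombination hx0, map_sum]
    simp

/-- A bin holds `2 ^ l` rounded items of size category `l`, so a demand of `u` items in that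
category costs `u / 2 ^ l`. -/
theorem exists_isFractional_of_demand {k : ℕ} (hR : IsRounding s k R) (u : Groups R → ℕ) :
    ∃ x, IsFractional s R (fun g => (u g : ℝ)) x ∧
      norm₁ x = ∑ g, (u g : ℝ) / 2 ^ g.1.1 := by
  classical
  let col : Groups R → Column R := fun g => Pi.single g (2 ^ g.1.1)
  set x : Column R →₀ ℝ := ∑ g, Finsupp.single (col g) ((u g : ℝ) / 2 ^ g.1.1)
  have hx0 : ∀ c, 0 ≤ x c := fun c => by
    simp only [x, Finsupp.finsetSum_apply]
    refine Finset.sum_nonneg fun j _ => ?_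
    rw [Finsupp.single_apply]
    split_ifs <;> positivity
  refine ⟨x, ⟨hx0, fun c hc => ?_, fun g => ?_⟩, ?_⟩
  · obtain ⟨g, -, hg⟩ := Finset.mem_biUnion.1 (Finsupp.support_finsetSum hc)
    rw [Finset.mem_singleton.1 (Finsupp.support_single_subset hg)]
    have hsize : groupSize s R g ≤ (2 : ℝ)⁻¹ ^ g.1.1 := Finset.sup'_le _ _ fun i hi =>
      (hR.category g.1.1 g.1.2.1 g.1.2.2 i hi).2
    rw [IsConfig, Finset.sum_eq_single g (fun g' _ hg' => by simp [col, hg'])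
      (by simp)]
    have h2 : ((2 : ℝ) ^ g.1.1) * (2 : ℝ)⁻¹ ^ g.1.1 = 1 := by
      rw [← mul_pow]; norm_num
    have := mul_le_mul_of_nonneg_left hsize (by positivity : (0 : ℝ) ≤ 2 ^ g.1.1)
    simpa [col] using this.trans h2.le
  · rw [cover_eq_linearCombination, map_sum]
    simp only [Finsupp.linearCombination_single, smul_eq_mul, col]
    rw [Finset.sum_eq_single g (fun g' _ hg' => by simp [hg'.symm]) (by simp)]
    simp
  · rw [norm₁_eq_linearCombination hx0, map_sum]
    simp

theorem card_members_eq_zero_of_lastPos_lt {l r : ℕ} {X : Block} (h : lastPos R l X < r) :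
    (members R (l, X, r)).card = 0 := by
  refine Finset.card_eq_zero.2 (Finset.eq_empty_of_forall_notMem fun i hi => ?_)
  have hi : R i = (l, X, r) := by simpa [members] using hi
  have : (R i).2.2 ≤ lastPos R l X :=
    Finset.le_sup (f := fun i => (R i).2.2) (by simp [hi])
  rw [hi] at this
  exact absurd this (not_le.2 h)

/-- The total increase of the group cardinalities along a block is at most one full group. -/
theorem sum_card_sub_card_prevMembers_le {k : ℕ} (hR : IsRounding s k R) (l : ℕ) (X : Block)
    (Q : ℕ) : ∑ r ∈ Finset.range Q,
      ((members R (l, X, r)).card - (prevMembers R (l, X, r)).card) ≤ 2 ^ l * k := by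
  have key : (members R (l, X, 0)).card ≤ 2 ^ l * k ∧ (members R (l, X, 1)).card ≤ 2 ^ l * k ∧
      ∀ r, 1 ≤ r → (members R (l, X, r + 1)).card ≤ (members R (l, X, r)).card := by
    cases X with
    | A =>
      refine ⟨hR.cardA_zero l, ?_, fun r hr => ?_⟩
      · rcases le_or_gt 1 (lastPos R l .A) with h | h
        · exact (hR.cardA l 1 le_rfl h).le
        · simp [card_members_eq_zero_of_lastPos_lt h]
      · rcases le_or_gt (r + 1) (lastPos R l .A) with h | h
        · rw [hR.cardA l _ (by omega) h, hR.cardA l _ hr (by omega)]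
        · simp [card_members_eq_zero_of_lastPos_lt h]
    | B =>
      have hle : ∀ r, (members R (l, Block.B, r)).card ≤ 2 ^ l * (k - 1) := fun r => by
        rcases lt_trichotomy r (lastPos R l .B) with h | h | h
        · exact (hR.cardB l r h).le
        · exact h ▸ hR.cardB_last l
        · simp [card_members_eq_zero_of_lastPos_lt h]
      have hk : 2 ^ l * (k - 1) ≤ 2 ^ l * k := Nat.mul_le_mul_left _ (Nat.sub_le k 1)
      refine ⟨(hle 0).trans hk, (hle 1).trans hk, fun r _ => ?_⟩
      rcases lt_or_ge r (lastPos R l .B) with h | h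
      · exact (hle _).trans (hR.cardB l r h).ge
      · simp [card_members_eq_zero_of_lastPos_lt (Nat.lt_succ_of_le h)]
  obtain ⟨h0, h1, h2⟩ := key
  have hsum : ∀ Q, ∑ r ∈ Finset.range (Q + 2),
      ((members R (l, X, r)).card - (prevMembers R (l, X, r)).card) ≤ 2 ^ l * k := by
    intro Q
    induction Q with
    | zero =>
      simp only [Finset.sum_range_succ, Finset.sum_range_zero, prevMembers, Finset.card_empty]
      omega
    | succ Q ih =>
      have hprev : prevMembers R (l, X, Q + 2) = members R (l, X, Q + 1) := rfl
      have : (members R (l, X, Q + 2)).card ≤ (members R (l, X, Q + 1)).card :=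
        h2 (Q + 1) (by omega)
      rw [Finset.sum_range_succ, show Q + 1 + 1 = Q + 2 from rfl, hprev]
      omega
  exact (Finset.sum_le_sum_of_subset (Finset.range_mono (by omega : Q ≤ Q + 2))).trans (hsum Q)

theorem sum_demand_le {k : ℕ} (hR : IsRounding s k R) (M : ℕ) (hM : ∀ i, (R i).1 < M) :
    ∑ g : Groups R, (((members R g.1).card - (prevMembers R g.1).card : ℕ) : ℝ) / 2 ^ g.1.1
      ≤ M * (2 * k) := by
  classical
  let f : Group → ℝ := fun g => (((members R g).card - (prevMembers R g).card : ℕ) : ℝ) / 2 ^ g.1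
  let Q := Finset.univ.sup (fun i => (R i).2.2) + 1
  have hblock : ∀ l X, ∑ r ∈ Finset.range Q, f (l, X, r) ≤ k := fun l X => by
    simp only [f]
    rw [← Finset.sum_div, div_le_iff₀ (by positivity), mul_comm, ← Nat.cast_sum]
    exact_mod_cast sum_card_sub_card_prevMembers_le hR l X Q
  calc ∑ g : Groups R, f g.1 = ∑ g ∈ Finset.univ.image R, f g :=
        Finset.sum_coe_sort (Finset.univ.image R) f
    _ ≤ ∑ g ∈ Finset.range M ×ˢ ({Block.A, Block.B} : Finset Block) ×ˢ Finset.range Q, f g := by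
        refine Finset.sum_le_sum_of_subset_of_nonneg (fun g hg => ?_) fun g _ _ => by positivity
        obtain ⟨i, -, rfl⟩ := Finset.mem_image.1 hg
        refine Finset.mem_product.2 ⟨Finset.mem_range.2 (hM i), Finset.mem_product.2 ⟨?_, ?_⟩⟩
        · cases (R i).2.1 <;> simp
        · exact Finset.mem_range.2 (Nat.lt_succ_of_le
            (Finset.le_sup (f := fun i => (R i).2.2) (Finset.mem_univ i)))
    _ = ∑ l ∈ Finset.range M, ∑ X ∈ ({Block.A, Block.B} : Finset Block),
          ∑ r ∈ Finset.range Q, f (l, X, r) := by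
        rw [Finset.sum_product]
        simp_rw [Finset.sum_product]
    _ ≤ ∑ l ∈ Finset.range M, ∑ X ∈ ({Block.A, Block.B} : Finset Block), (k : ℝ) :=
        Finset.sum_le_sum fun l _ => Finset.sum_le_sum fun X _ => hblock l X
    _ = M * (2 * k) := by simp

/-- Items of size at least `ε / 14` lie in the size categories `0, …, ⌊log₂ (1 / ε)⌋ + 4`. -/
theorem category_lt {k : ℕ} (hR : IsRounding s k R) {ε : ℝ} (hε : 0 < ε)
    (hs : ∀ i, ε / 14 ≤ s i) (i : I) : ((R i).1 : ℤ) < ⌊Real.logb 2 (1 / ε)⌋ + 5 := by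
  have h := (hR.category (R i).1 (R i).2.1 (R i).2.2 i (by simp [members])).2
  have h2 : ((2 : ℝ) ^ (R i).1) * (2 : ℝ)⁻¹ ^ (R i).1 = 1 := by
    rw [← mul_pow]; norm_num
  have h3 : (2 : ℝ) ^ (R i).1 * (ε / 14) ≤ 1 :=
    (mul_le_mul_of_nonneg_left ((hs i).trans h) (by positivity)).trans h2.le
  have h4 : (2 : ℝ) ^ (((R i).1 : ℝ) - 4) ≤ 1 / ε := by
    rw [Real.rpow_sub (by norm_num), Real.rpow_natCast, div_le_div_iff₀ (by positivity) hε]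
    norm_num
    linarith
  have h5 : (((R i).1 : ℤ) - 4 : ℤ) ≤ ⌊Real.logb 2 (1 / ε)⌋ := by
    rw [Int.le_floor, Real.le_logb_iff_rpow_le (by norm_num) (by positivity)]
    push_cast
    exact h4
  omega

/-- The choice of the group parameter makes the demand that the shifted packing leaves uncovered
cost at most `ε · SIZE`. -/
theorem lin_rhs_le {ε : ℝ} (hε : 0 < ε) (hε1 : ε ≤ 1) (hs : ∀ i, ε / 14 ≤ s i)
    (hs1 : ∀ i, s i ≤ 1) (hR : IsRounding s (groupParam s ε) R) :
    lin s R (rhs R) ≤ (1 + ε) * opt s := by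
  have hpos : ∀ i, 0 < s i := fun i => (by positivity : 0 < ε / 14).trans_le (hs i)
  obtain ⟨B, hB⟩ := exists_isPacking_opt hs1
  obtain ⟨x, hx, hxn⟩ := exists_isFractional_prevMembers hR hpos hB
  obtain ⟨z, hz, hzn⟩ := exists_isFractional_of_demand hR
    fun g => (members R g.1).card - (prevMembers R g.1).card
  have hlog : 0 ≤ ⌊Real.logb 2 (1 / ε)⌋ :=
    Int.floor_nonneg.2 (Real.logb_nonneg (by norm_num) ((one_le_div hε).2 hε1))
  obtain ⟨M, hM⟩ := Int.eq_ofNat_of_zero_le (by omega : 0 ≤ ⌊Real.logb 2 (1 / ε)⌋ + 5)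
  have hMR : (⌊Real.logb 2 (1 / ε)⌋ : ℝ) + 5 = M := by exact_mod_cast hM
  have hM0 : (0 : ℝ) < M := by
    have : 0 < M := by omega
    exact_mod_cast this
  have hdem := sum_demand_le hR M fun i => by
    have := category_lt hR hε hs i
    omega
  have hk : (groupParam s ε : ℝ) * (2 * M) ≤ totalSize s * ε := by
    have h0 : 0 ≤ totalSize s * ε :=
      mul_nonneg (Finset.sum_nonneg fun i _ => (hpos i).le) hε.le
    rw [← le_div_iff₀ (by positivity), groupParam, hMR]
    exact Nat.floor_le (by positivity)
  have hsize := mul_le_mul_of_nonneg_right (totalSize_le_of_isPacking hB) hε.le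
  have hfrac : IsFractional s R (rhs R) (x + z) := (hx.add hz).mono fun g => by
    rw [rhs]
    exact_mod_cast (by omega : (members R g.1).card ≤
      (prevMembers R g.1).card + ((members R g.1).card - (prevMembers R g.1).card))
  have := lin_le hfrac
  rw [norm₁_add hx.1 hz.1, hxn, hzn] at this
  linarith

/-! ### Packings that correspond to an integral solution -/

/-- A partial assignment that respects the capacities extends to all elements of `T` if the total
capacity suffices: as long as an element is unassigned, some target has capacity left. -/
theorem exists_assignment_extending {τ κ : Type*} [DecidableEq τ] [DecidableEq κ] {T : Finset τ}
    {J : Finset κ} {cap : κ → ℕ} (hcap : T.card ≤ ∑ j ∈ J, cap j) {T₀ : Finset τ} {f₀ : τ → κ}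
    (hT₀ : T₀ ⊆ T) (hJ : ∀ i ∈ T₀, f₀ i ∈ J)
    (hload : ∀ j ∈ J, (T₀.filter fun i => f₀ i = j).card ≤ cap j) :
    ∃ f : τ → κ, (∀ i ∈ T₀, f i = f₀ i) ∧ (∀ i ∈ T, f i ∈ J) ∧
      ∀ j ∈ J, (T.filter fun i => f i = j).card ≤ cap j := by
  induction hn : (T \ T₀).card generalizing T₀ f₀ with
  | zero =>
    have : T = T₀ := (Finset.sdiff_eq_empty_iff_subset.1 (Finset.card_eq_zero.1 hn)).antisymm hT₀
    subst this
    exact ⟨f₀, fun _ _ => rfl, hJ, hload⟩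
  | succ n ih =>
    obtain ⟨a, ha⟩ := Finset.card_pos.1 (by omega : 0 < (T \ T₀).card)
    obtain ⟨haT, haT₀⟩ := Finset.mem_sdiff.1 ha
    have hlt : ∑ j ∈ J, (T₀.filter fun i => f₀ i = j).card < ∑ j ∈ J, cap j := by
      rw [← Finset.card_eq_sum_card_fiberwise hJ]
      exact (Finset.card_lt_card ⟨hT₀, fun h => haT₀ (h haT)⟩).trans_le hcap
    obtain ⟨j₀, hj₀, hj₀lt⟩ := Finset.exists_lt_of_sum_lt hlt
    have hne : ∀ i ∈ T₀, i ≠ a := fun i hi h => haT₀ (h ▸ hi)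
    have hupd : ∀ i ∈ T₀, Function.update f₀ a j₀ i = f₀ i := fun i hi =>
      Function.update_of_ne (hne i hi) _ _
    have hfilter : ∀ j, (T₀.filter fun i => Function.update f₀ a j₀ i = j) =
        T₀.filter fun i => f₀ i = j := fun j =>
      Finset.filter_congr fun i hi => by rw [hupd i hi]
    obtain ⟨f, hf, hfJ, hfload⟩ := ih (T₀ := insert a T₀) (f₀ := Function.update f₀ a j₀)
      (Finset.insert_subset haT hT₀)
      (fun i hi => by
        rcases Finset.mem_insert.1 hi with rfl | hi
        · simpa using hj₀
        · rw [hupd i hi]; exact hJ i hi)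
      (fun j hj => by
        rw [Finset.filter_insert, hfilter]
        split_ifs with h
        · rw [Function.update_self] at h
          subst h
          exact (Finset.card_insert_le _ _).trans hj₀lt
        · exact hload j hj)
      (by
        rw [Finset.sdiff_insert, Finset.card_erase_of_mem ha, hn]
        rfl)
    exact ⟨f, fun i hi => (hf i (Finset.mem_insert_of_mem hi)).trans (hupd i hi), hfJ, hfload⟩

theorem le_roundedSize (i : I) : s i ≤ roundedSize s R i :=
  Finset.le_sup' s (by simp [members])

/-- Items that occupy slots of a configuration fit into one bin, also after rounding. -/
theorem sum_roundedSize_le_one (hs : ∀ i, 0 < s i) {B : I → ℕ} {c : Column R} {j : ℕ}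
    (hc : IsConfig s R c) (hslots : ∀ g : Groups R,
      ((members R g.1).filter fun i => B i = j).card ≤ c g) :
    ∑ i with B i = j, roundedSize s R i ≤ 1 := by
  classical
  let toGroup : I → Groups R := fun i => ⟨R i, Finset.mem_image_of_mem R (Finset.mem_univ i)⟩
  rw [← Finset.sum_fiberwise _ toGroup]
  refine (Finset.sum_le_sum fun g _ => ?_).trans hc
  have hfilter : ((Finset.univ.filter fun i => B i = j).filter fun i => toGroup i = g) =
      (members R g.1).filter fun i => B i = j := by
    ext i
    simp [members, toGroup, Subtype.ext_iff, and_comm]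
  have hval : ∀ i ∈ (members R g.1).filter fun i => B i = j,
      roundedSize s R i = groupSize s R g := fun i hi => by
    have : R i = g.1 := by simpa [members] using (Finset.mem_filter.1 hi).1
    exact congrArg (groupSize s R) (Subtype.ext this)
  rw [hfilter, Finset.sum_congr rfl hval, Finset.sum_const, nsmul_eq_mul]
  exact mul_le_mul_of_nonneg_right (Nat.cast_le.2 (hslots g)) (groupSize_pos hs g).le

/-- Bins `P` with prescribed configurations and contents extend to a packing that corresponds to
the integral solution `y`, provided that `P` uses no configuration more often than `y` does. -/
theorem exists_corresponds_extending (hs : ∀ i, 0 < s i) {y : Column R →₀ ℕ}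
    (hy : IsFractional s R (rhs R) (toReal y)) {P : Finset ℕ} {B₀ : I → ℕ}
    {conf₀ : ℕ → Column R} (hP : P ⊆ Finset.Icc 1 (total y))
    (hcount : ∀ c, (P.filter fun j => conf₀ j = c).card ≤ y c)
    (hslots : ∀ j ∈ P, ∀ g : Groups R,
      ((members R g.1).filter fun i => B₀ i = j).card ≤ conf₀ j g) :
    ∃ B conf, Corresponds s R y B conf ∧
      ∀ j ∈ P, conf j = conf₀ j ∧ ∀ i, B₀ i = j → B i = j := by
  classical
  obtain ⟨conf, hconf, hconfJ, hconfload⟩ := exists_assignment_extending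
    (T := Finset.Icc 1 (total y)) (J := y.support) (cap := y) (T₀ := P) (f₀ := conf₀)
    (by rw [Nat.card_Icc]; exact le_rfl) hP
    (fun j hj => by
      have : 0 < (P.filter fun j' => conf₀ j' = conf₀ j).card :=
        Finset.card_pos.2 ⟨j, Finset.mem_filter.2 ⟨hj, rfl⟩⟩
      exact Finsupp.mem_support_iff.2 (this.trans_le (hcount _)).ne')
    (fun c _ => hcount c)
  have hsum : ∑ c ∈ y.support, ((Finset.Icc 1 (total y)).filter fun j => conf j = c).card =
      ∑ c ∈ y.support, y c := by
    rw [← Finset.card_eq_sum_card_fiberwise hconfJ, Nat.card_Icc]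
    rfl
  have hcnt : ∀ c, ((Finset.Icc 1 (total y)).filter fun j => conf j = c).card = y c := by
    intro c
    by_cases hc : c ∈ y.support
    · exact (Finset.sum_eq_sum_iff_of_le hconfload).1 hsum c hc
    · rw [Finsupp.notMem_support_iff.1 hc, Finset.card_eq_zero,
        Finset.filter_eq_empty_iff]
      rintro j hj rfl
      exact hc (hconfJ j hj)
  have hcap : ∀ g : Groups R, (members R g.1).card ≤
      ∑ j ∈ Finset.Icc 1 (total y), conf j g := by
    intro g
    have h1 : ∑ j ∈ Finset.Icc 1 (total y), conf j g = ∑ c ∈ y.support, y c * c g := by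
      rw [← Finset.sum_fiberwise_of_maps_to hconfJ]
      refine Finset.sum_congr rfl fun c _ => ?_
      rw [← hcnt c, ← smul_eq_mul, ← Finset.sum_const]
      exact Finset.sum_congr rfl fun j hj => by rw [(Finset.mem_filter.1 hj).2]
    have h2 := hy.2.2 g
    rw [cover, Finsupp.sum, support_toReal, rhs] at h2
    rw [h1]
    simp only [toReal_apply] at h2
    exact_mod_cast h2
  have hassign : ∀ g : Groups R, ∃ f : I → ℕ,
      (∀ i ∈ (members R g.1).filter fun i => B₀ i ∈ P, f i = B₀ i) ∧
      (∀ i ∈ members R g.1, f i ∈ Finset.Icc 1 (total y)) ∧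
      ∀ j ∈ Finset.Icc 1 (total y),
        ((members R g.1).filter fun i => f i = j).card ≤ conf j g := fun g =>
    exists_assignment_extending (hcap g) (Finset.filter_subset _ _)
      (fun i hi => hP (Finset.mem_filter.1 hi).2) (fun j _ => by
        by_cases hjP : j ∈ P
        · rw [hconf j hjP]
          refine (Finset.card_le_card fun i hi => ?_).trans (hslots j hjP g)
          simp only [Finset.mem_filter] at hi ⊢
          exact ⟨hi.1.1, hi.2⟩
        · rw [Finset.card_eq_zero.2]
          · exact Nat.zero_le _
          · rw [Finset.filter_eq_empty_iff]
            rintro i hi rfl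
            exact hjP (Finset.mem_filter.1 hi).2)
  choose f hfix hmem hload using hassign
  let toGroup : I → Groups R := fun i => ⟨R i, Finset.mem_image_of_mem R (Finset.mem_univ i)⟩
  have hself : ∀ i, i ∈ members R (toGroup i).1 := fun i => by simp [members, toGroup]
  set B : I → ℕ := fun i => f (toGroup i) i with hB
  have hBmem : ∀ i, B i ∈ Finset.Icc 1 (total y) := fun i => hmem _ i (hself i)
  have hBslots : ∀ j ∈ Finset.Icc 1 (total y), ∀ g : Groups R,
      ((members R g.1).filter fun i => B i = j).card ≤ conf j g := by
    intro j hj g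
    convert hload g j hj using 2
    refine Finset.filter_congr fun i hi => ?_
    have hRi : R i = g.1 := by simpa [members] using hi
    have hgi : toGroup i = g := Subtype.ext hRi
    change f (toGroup i) i = j ↔ f g i = j
    rw [hgi]
  refine ⟨B, conf, ⟨⟨fun i => Finset.mem_Icc.1 (hBmem i), fun j => ?_⟩, hcnt, hBslots⟩,
    fun j hj => ⟨hconf j hj, fun i hi => ?_⟩⟩
  · by_cases hj : j ∈ Finset.Icc 1 (total y)
    · refine sum_roundedSize_le_one hs (hy.2.1 _ ?_) (hBslots j hj)
      rw [support_toReal]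
      exact hconfJ j hj
    · rw [Finset.sum_eq_zero]
      · exact zero_le_one
      · intro i hi
        exact absurd ((Finset.mem_filter.1 hi).2 ▸ hBmem i) hj
  · subst hi
    exact hfix _ i (Finset.mem_filter.2 ⟨hself i, hj⟩)

/-- Every integral solution is at least as expensive as an optimal packing. -/
theorem opt_le_total (hs : ∀ i, 0 < s i) {y : Column R →₀ ℕ}
    (hy : IsFractional s R (rhs R) (toReal y)) : opt s ≤ total y := by
  obtain ⟨B, conf, hB, -⟩ := exists_corresponds_extending hs hy (P := ∅) (B₀ := fun _ => 0)
    (conf₀ := fun _ => 0) (by simp) (by simp) (by simp)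
  exact Nat.sInf_le ⟨B, hB.packing.1, fun j =>
    (Finset.sum_le_sum fun i _ => le_roundedSize i).trans (hB.packing.2 j)⟩

/-- Renumbering the bins preserves correspondence. -/
theorem Corresponds.perm {y : Column R →₀ ℕ} {B : I → ℕ} {conf : ℕ → Column R}
    (h : Corresponds s R y B conf) (σ : Equiv.Perm ℕ)
    (hσ : ∀ j, σ j ∈ Finset.Icc 1 (total y) ↔ j ∈ Finset.Icc 1 (total y)) :
    Corresponds s R y (fun i => σ (B i)) (fun j => conf (σ.symm j)) := by
  have hsymm : ∀ j, σ.symm j ∈ Finset.Icc 1 (total y) ↔ j ∈ Finset.Icc 1 (total y) := fun j => by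
    rw [← hσ, σ.apply_symm_apply]
  refine ⟨⟨fun i => Finset.mem_Icc.1 ((hσ _).2 (Finset.mem_Icc.2 (h.packing.1 i))),
    fun j => ?_⟩, fun c => ?_, fun j hj g => ?_⟩
  · simp only [← Equiv.eq_symm_apply]
    exact h.packing.2 _
  · rw [← h.count c]
    refine Finset.card_bij (fun j _ => σ.symm j) (fun j hj => ?_)
      (fun j _ j' _ hjj' => σ.symm.injective hjj') fun j hj => ⟨σ j, ?_, σ.symm_apply_apply j⟩
    · rw [Finset.mem_filter] at hj ⊢
      exact ⟨(hsymm j).2 hj.1, hj.2⟩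
    · rw [Finset.mem_filter] at hj ⊢
      exact ⟨(hσ j).2 hj.1, by rw [σ.symm_apply_apply]; exact hj.2⟩
  · simp only [← Equiv.eq_symm_apply]
    exact h.slots _ ((hsymm j).2 hj) g

theorem mem_changedBins {ι : Type*} {N N' : ℕ} {B B' : I → ℕ} {conf conf' : ℕ → ι} {j : ℕ} :
    j ∈ changedBins N B conf N' B' conf' ↔ j ∈ Finset.Icc 1 (max N N') ∧
      ¬ (j ≤ N ∧ j ≤ N' ∧ conf' j = conf j ∧ ∀ i, B i = j → B' i = j) := by
  classical
  rw [changedBins, Finset.mem_filter]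

/-- Passing from a packing for `y` to a packing for `y'` changes only the bins whose numbers exist
in one of them, at most `∑ (y - y')⁺` bins whose configurations are given up, and two bins that are
exchanged in order that the last bin contains an item. -/
theorem exists_corresponds_card_changedBins_le [Nonempty I] (hs : ∀ i, 0 < s i)
    {y y' : Column R →₀ ℕ} {B : I → ℕ} {conf : ℕ → Column R} (h : Corresponds s R y B conf)
    (hy' : IsFractional s R (rhs R) (toReal y')) :
    ∃ B' conf', Corresponds s R y' B' conf' ∧ maxBin B' = total y' ∧
      (changedBins (total y) B conf (total y') B' conf').card ≤
        (max (total y) (total y') - min (total y) (total y')) + total (y - y') + 2 := by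
  classical
  set N := total y
  set N' := total y'
  set Q : Finset ℕ := Finset.Icc 1 (min N N')
  -- keep as many bins of each configuration as `y'` admits
  have hQ : ∀ c, (Q.filter fun j => conf j = c).card ≤ y c := fun c => by
    rw [← h.count c]
    exact Finset.card_le_card (Finset.filter_subset_filter _
      (Finset.Icc_subset_Icc_right (min_le_left _ _)))
  choose Pc hPcsub hPccard using fun c => Finset.exists_subset_card_eq
    (min_le_left ((Q.filter fun j => conf j = c).card) (y' c))
  set P := Q.filter fun j => j ∈ Pc (conf j) with hP
  have hPfilter : ∀ c, (P.filter fun j => conf j = c) = Pc c := by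
    intro c
    ext j
    simp only [hP, Finset.mem_filter]
    constructor
    · rintro ⟨⟨-, h1⟩, rfl⟩
      exact h1
    · intro hj
      obtain ⟨h1, rfl⟩ := Finset.mem_filter.1 (hPcsub c hj)
      exact ⟨⟨h1, hj⟩, rfl⟩
  have hPQ : P ⊆ Q := Finset.filter_subset _ _
  have hconfmem : ∀ j ∈ Q, conf j ∈ y.support := fun j hj => by
    have : 0 < (Q.filter fun j' => conf j' = conf j).card :=
      Finset.card_pos.2 ⟨j, Finset.mem_filter.2 ⟨hj, rfl⟩⟩
    exact Finsupp.mem_support_iff.2 (this.trans_le (hQ _)).ne'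
  have hlost : (Q \ P).card ≤ total (y - y') := by
    have hsub : (y - y').support ⊆ y.support := fun c hc => by
      rw [Finsupp.mem_support_iff, Finsupp.coe_tsub, Pi.sub_apply] at hc
      exact Finsupp.mem_support_iff.2 (by omega)
    rw [total_eq_sum hsub, Finset.card_sdiff_of_subset hPQ,
      Finset.card_eq_sum_card_fiberwise hconfmem,
      Finset.card_eq_sum_card_fiberwise (fun j hj => hconfmem j (hPQ hj)), Nat.sub_le_iff_le_add,
      ← Finset.sum_add_distrib]
    refine Finset.sum_le_sum fun c _ => ?_
    have := hQ c
    rw [hPfilter, hPccard, Finsupp.coe_tsub, Pi.sub_apply]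
    omega
  obtain ⟨B₁, conf₁, h₁, hkeep⟩ := exists_corresponds_extending hs hy' (P := P) (B₀ := B)
    (conf₀ := conf) (hPQ.trans (Finset.Icc_subset_Icc_right (min_le_right _ _)))
    (fun c => by rw [hPfilter, hPccard]; exact min_le_right _ _)
    (fun j hj => h.slots j (Finset.Icc_subset_Icc_right (min_le_left _ _) (hPQ hj)))
  -- exchange the bin of some item with the last bin, so that the last bin is in use
  obtain ⟨i₀⟩ := ‹Nonempty I›
  have hb := h₁.packing.1 i₀
  have hσ : ∀ j, Equiv.swap (B₁ i₀) N' j ∈ Finset.Icc 1 N' ↔ j ∈ Finset.Icc 1 N' := fun j => by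
    have hbm : B₁ i₀ ∈ Finset.Icc 1 N' := Finset.mem_Icc.2 hb
    have hNm : N' ∈ Finset.Icc 1 N' := Finset.mem_Icc.2 ⟨hb.1.trans hb.2, le_rfl⟩
    rw [Equiv.swap_apply_def]
    split_ifs with h1 h2
    · simp only [h1, hbm, hNm]
    · simp only [h2, hbm, hNm]
    · rfl
  have h₂ := h₁.perm (Equiv.swap (B₁ i₀) N') hσ
  refine ⟨_, _, h₂, ?_, ?_⟩
  · refine (Finset.sup_le fun i _ => (h₂.packing.1 i).2).antisymm ?_
    refine le_trans ?_ (Finset.le_sup (Finset.mem_univ i₀))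
    simp [N']
  · have hsub : changedBins N B conf N' (fun i => Equiv.swap (B₁ i₀) N' (B₁ i))
        (fun j => conf₁ ((Equiv.swap (B₁ i₀) N').symm j)) ⊆
        (Finset.Icc 1 (max N N') \ Q) ∪ (Q \ P) ∪ {B₁ i₀, N'} := by
      intro j hj
      rw [mem_changedBins] at hj
      obtain ⟨hjmax, hj⟩ := hj
      by_contra hnot
      simp only [Finset.mem_union, Finset.mem_sdiff, Finset.mem_insert, Finset.mem_singleton,
        not_or, not_and, not_not] at hnot
      obtain ⟨⟨h1, h2⟩, hne1, hne2⟩ := hnot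
      have hjQ := h1 hjmax
      have hjP := h2 hjQ
      have hle := (Finset.mem_Icc.1 hjQ).2
      refine hj ⟨hle.trans (min_le_left _ _), hle.trans (min_le_right _ _), ?_, fun i hi => ?_⟩
      · rw [Equiv.symm_swap, Equiv.swap_apply_of_ne_of_ne hne1 hne2]
        exact (hkeep j hjP).1
      · rw [(hkeep j hjP).2 i hi, Equiv.swap_apply_of_ne_of_ne hne1 hne2]
    have hQmax : (Finset.Icc 1 (max N N') \ Q).card = max N N' - min N N' := by
      rw [Finset.card_sdiff_of_subset (Finset.Icc_subset_Icc_right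
        ((min_le_left _ _).trans (le_max_left _ _))), Nat.card_Icc, Nat.card_Icc]
      omega
    calc _ ≤ _ := Finset.card_le_card hsub
      _ ≤ (Finset.Icc 1 (max N N') \ Q).card + (Q \ P).card +
          ({B₁ i₀, N'} : Finset ℕ).card :=
        (Finset.card_union_le _ _).trans (Nat.add_le_add_right (Finset.card_union_le _ _) _)
      _ ≤ _ := Nat.add_le_add (Nat.add_le_add hQmax.le hlost) Finset.card_le_two

/-! ### The choices of the algorithm -/

section Vectors
variable {ι : Type*}

theorem exists_isSortedSupport (y : ι →₀ ℕ) : ∃ a, IsSortedSupport y a := by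
  classical
  let r : ι → ι → Prop := fun c c' => y c ≤ y c'
  have : Std.Total r := ⟨fun c c' => le_total (y c) (y c')⟩
  have : IsTrans ι r := ⟨fun _ _ _ h h' => le_trans h h'⟩
  have hperm := List.perm_insertionSort r y.support.toList
  exact ⟨_, hperm.nodup_iff.2 (Finset.nodup_toList _),
    fun c => hperm.mem_iff.trans Finset.mem_toList, List.pairwise_insertionSort r _⟩

theorem exists_isCutoff (y : ι →₀ ℕ) (a : List ι) {t : ℝ} (ht : 0 ≤ t) :
    ∃ l, IsCutoff y a t l := by
  have hb : BddAbove {l | l ≤ a.length ∧ (((a.take l).map y).sum : ℝ) ≤ t} :=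
    ⟨a.length, fun l hl => hl.1⟩
  exact ⟨_, Nat.sSup_mem ⟨0, by simpa using ht⟩ hb, fun l hl => le_csSup hb hl⟩

theorem exists_isRemoval {z : ι →₀ ℝ} (hz : ∀ c, 0 ≤ z c) {t : ℝ} (ht : 0 < t) :
    ∃ d, IsRemoval z t d := by
  by_cases h : ∃ e, InV z e ∧ (total e : ℝ) = t
  · obtain ⟨e, he, het⟩ := h
    exact ⟨e, he, Or.inl het⟩
  · let A : Set ℕ := {n | ∃ e, InV z e ∧ total e = n ∧ (n : ℝ) < t}
    have hb : BddAbove A := ⟨⌊t⌋₊, by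
      rintro n ⟨-, -, -, hn⟩
      exact Nat.le_floor hn.le⟩
    have hne : A.Nonempty := ⟨0, 0, fun c => by simpa using hz c, rfl, by simpa using ht⟩
    obtain ⟨d, hd, hdn, hdt⟩ := Nat.sSup_mem hne hb
    exact ⟨d, hd, Or.inr ⟨h, hdn ▸ hdt, fun e he het =>
      hdn ▸ le_csSup hb ⟨e, he, rfl, het⟩⟩⟩

theorem exists_le_total_eq (y : ι →₀ ℕ) {n : ℕ} (hn : n ≤ total y) :
    ∃ e, e ≤ y ∧ total e = n := by
  induction hk : total y - n generalizing y with
  | zero => exact ⟨y, le_rfl, by omega⟩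
  | succ k ih =>
    have hy : y ≠ 0 := by
      rintro rfl
      simp [total] at hk
    obtain ⟨c, hc⟩ := Finsupp.ne_iff.1 hy
    have hle : Finsupp.single c 1 ≤ y :=
      Finsupp.single_le_iff.2 (Nat.one_le_iff_ne_zero.2 hc)
    have htot : total (y - Finsupp.single c 1) + 1 = total y := by
      conv_rhs => rw [← tsub_add_cancel_of_le hle, total_add]
      simp [total]
    obtain ⟨e, he, hen⟩ := ih (y - Finsupp.single c 1) (by omega) (by omega)
    exact ⟨e, he.trans tsub_le_self, hen⟩

/-- A removed vector has norm more than `t - 1`, or it leaves less than `1` in each component. -/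
theorem IsRemoval.lt_total_or {z : ι →₀ ℝ} (hz : ∀ c, 0 ≤ z c) {t : ℝ} (ht : 0 ≤ t)
    {d : ι →₀ ℕ} (h : IsRemoval z t d) : t - 1 < total d ∨ ∀ c, z c < d c + 1 := by
  obtain ⟨hd, h | ⟨hnot, hdt, hmax⟩⟩ := h
  · left; linarith
  set F : ι →₀ ℕ := z.mapRange Nat.floor Nat.floor_zero
  have hF : InV z F := fun c => Nat.floor_le (hz c)
  have hdF : d ≤ F := fun c => Nat.le_floor (hd c)
  rcases lt_or_ge (total F : ℝ) t with hFt | hFt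
  · right
    -- all of `⌊z⌋` may be removed, so maximality forces `d = ⌊z⌋`
    obtain ⟨w, hw⟩ := exists_add_of_le hdF
    have htot := hmax F hF hFt
    rw [hw, total_add] at htot
    have hw0 : w = 0 := by
      have : norm₁ (toReal w) = 0 := by
        rw [norm₁_toReal]
        exact_mod_cast (by omega : total w = 0)
      ext c
      have := DFunLike.congr_fun (eq_zero_of_norm₁_eq_zero this) c
      simpa using this
    intro c
    have : F c = d c := by rw [hw, hw0, add_zero]
    rw [← this]
    exact Nat.lt_floor_add_one (z c)
  · left
    -- a vector of norm `⌊t⌋` may be removed; `t` is not an integer, since norm `t` is impossible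
    obtain ⟨e, heF, he⟩ := exists_le_total_eq F
      (by exact_mod_cast (Nat.floor_le ht).trans hFt : ⌊t⌋₊ ≤ total F)
    have heV : InV z e := fun c => (Nat.cast_le.2 (heF c)).trans (hF c)
    have het : (total e : ℝ) < t :=
      lt_of_le_of_ne (he ▸ Nat.floor_le ht) fun h => hnot ⟨e, heV, h⟩
    have h1 : (⌊t⌋₊ : ℝ) ≤ total d := by exact_mod_cast he ▸ hmax e heV het
    linarith [Nat.lt_floor_add_one t]

theorem IsRemoval.total_le {z : ι →₀ ℝ} {t : ℝ} {d : ι →₀ ℕ} (h : IsRemoval z t d) :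
    (total d : ℝ) ≤ t := by
  obtain ⟨-, h | ⟨-, h, -⟩⟩ := h
  exacts [h.le, h.le]

theorem roundUp_apply (x' : ι →₀ ℝ) (ybar : ι →₀ ℕ) (c : ι) :
    roundUp x' ybar c = if x' c = 0 then 0 else max ⌈x' c⌉₊ (ybar c) := by
  classical
  rw [roundUp, Finsupp.zipWith_apply]

theorem le_roundUp (x' : ι →₀ ℝ) (ybar : ι →₀ ℕ) (c : ι) : x' c ≤ roundUp x' ybar c := by
  rw [roundUp_apply]
  split_ifs with h
  · simp [h]
  · exact (Nat.le_ceil _).trans (Nat.cast_le.2 (le_max_left _ _))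

/-- If a vector of natural numbers lies below `x + 1` on the support of `x` and vanishes elsewhere,
then its norm exceeds that of `x` by at most the number of nonzero components. -/
theorem total_le_norm₁_add_card {x : ι →₀ ℝ} (hx : ∀ c, 0 ≤ x c) {y : ι →₀ ℕ}
    (hsupp : y.support ⊆ x.support) (h : ∀ c, (y c : ℝ) ≤ x c + 1) :
    (total y : ℝ) ≤ norm₁ x + x.support.card := by
  rw [total_eq_sum hsupp, norm₁, Finsupp.sum]
  push_cast
  rw [Finset.card_eq_sum_ones, Nat.cast_sum, ← Finset.sum_add_distrib]
  exact Finset.sum_le_sum fun c _ => by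
    rw [abs_of_nonneg (hx c), Nat.cast_one]
    exact h c

theorem total_ceil_le {x : ι →₀ ℝ} (hx : ∀ c, 0 ≤ x c) :
    (total (x.mapRange Nat.ceil Nat.ceil_zero) : ℝ) ≤ norm₁ x + x.support.card :=
  total_le_norm₁_add_card hx (Finsupp.support_mapRange) fun c => (Nat.ceil_lt_add_one (hx c)).le

theorem total_filter_mem {y : ι →₀ ℕ} {a : List ι} (ha : a.Nodup) [DecidablePred (· ∈ a)] :
    total (y.filter (· ∈ a)) = (a.map y).sum := by
  classical
  rw [total_eq_sum (T := a.toFinset), ← List.sum_toFinset _ ha]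
  · exact Finset.sum_congr rfl fun c hc => Finsupp.filter_apply_pos _ _ (List.mem_toFinset.1 hc)
  · intro c hc
    rw [Finsupp.support_filter, Finset.mem_filter] at hc
    exact List.mem_toFinset.2 hc.2

/-- If `l ≤ m`, then the `l + 1` smallest components sum up to more than `(m + 2) τ`, so the last of
them and all larger ones are at least `τ`. This bounds their number by the norm of `y`. -/
theorem IsCutoff.card_sub_le {y : ι →₀ ℕ} {a : List ι} {l m : ℕ} {τ : ℝ} (hτ : 0 ≤ τ)
    (ha : IsSortedSupport y a) (hl : IsCutoff y a ((m + 2) * τ) l) (hlm : l ≤ m)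
    (hy : (m + 2) * τ ≤ total y) :
    ((a.length : ℝ) - l + m + 1) * τ ≤ total y := by
  obtain ⟨⟨hlen, -⟩, hmax⟩ := hl
  have htotal : total y = (a.map y).sum := by
    classical
    rw [total_eq_sum (T := a.toFinset), List.sum_toFinset _ ha.1]
    exact fun c hc => List.mem_toFinset.2 ((ha.2.1 c).2 hc)
  rcases hlen.eq_or_lt with hlen | hlen
  · rw [hlen]
    nlinarith
  set w := y a[l]
  have htake : ∀ n ∈ (a.take (l + 1)).map y, n ≤ w := by
    intro n hn
    rw [List.mem_map] at hn
    obtain ⟨c, hc, rfl⟩ := hn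
    obtain ⟨i, hi, rfl⟩ := List.mem_iff_getElem.1 hc
    rw [List.length_take] at hi
    rw [List.getElem_take]
    rcases (by omega : i = l ∨ i < l) with rfl | h
    · exact le_rfl
    · exact List.pairwise_iff_getElem.1 ha.2.2 i l _ _ h
  have hdrop : ∀ n ∈ (a.drop (l + 1)).map y, w ≤ n := by
    intro n hn
    rw [List.mem_map] at hn
    obtain ⟨c, hc, rfl⟩ := hn
    obtain ⟨i, hi, rfl⟩ := List.mem_iff_getElem.1 hc
    rw [List.getElem_drop]
    exact List.pairwise_iff_getElem.1 ha.2.2 l _ _ _ (by omega)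
  have h1 := List.sum_le_card_nsmul _ w htake
  have h2 := List.card_nsmul_le_sum _ w hdrop
  simp only [List.length_map, List.length_take, List.length_drop, smul_eq_mul] at h1 h2
  rw [min_eq_left (by omega)] at h1
  have h3 : (m + 2) * τ < (((a.take (l + 1)).map y).sum : ℝ) := by
    by_contra hcon
    have := hmax ⟨hlen, not_lt.1 hcon⟩
    omega
  have h1' : (((a.take (l + 1)).map y).sum : ℝ) ≤ (l + 1) * w := by exact_mod_cast h1
  have h2' : ((a.length : ℝ) - (l + 1)) * w ≤ (((a.drop (l + 1)).map y).sum : ℝ) := by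
    have : ((a.length - (l + 1) : ℕ) : ℝ) * w ≤ (((a.drop (l + 1)).map y).sum : ℝ) := by
      exact_mod_cast h2
    rwa [Nat.cast_sub hlen, Nat.cast_succ] at this
  have hsum : (total y : ℝ) = (((a.take (l + 1)).map y).sum : ℝ) +
      (((a.drop (l + 1)).map y).sum : ℝ) := by
    rw [htotal, ← Nat.cast_add, ← List.sum_append, ← List.map_append, List.take_append_drop]
  have hlm' : (l : ℝ) ≤ m := Nat.cast_le.2 hlm
  have hw : τ ≤ w := by
    by_contra hcon
    have hw0 : (0 : ℝ) ≤ w := Nat.cast_nonneg _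
    nlinarith
  have hlen' : (l : ℝ) + 1 ≤ a.length := by exact_mod_cast hlen
  nlinarith

end Vectors

/-! ### The fractional part of the algorithm -/

theorem xFix_eq_smul {ι : Type*} (δ : ℝ) (α : ℕ) (x : ι →₀ ℝ) :
    xFix δ α x = (1 - 2 * (α * (1 / δ + 1)) / norm₁ x) • x := by
  rw [xFix, xVar, sub_smul, one_smul]

section Exchanged
variable {δ : ℝ} {α : ℕ} {x : Column R →₀ ℝ}

theorem xFix_nonneg (hx : ∀ c, 0 ≤ x c) (hβ : 2 * (α * (1 / δ + 1)) ≤ norm₁ x) (c : Column R) :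
    0 ≤ xFix δ α x c := by
  rw [xFix_eq_smul]
  exact mul_nonneg (sub_nonneg.2 (div_le_one_of_le₀ hβ (norm₁_nonneg x))) (hx c)

theorem xFix_le (hδ : 0 < δ) (hx : ∀ c, 0 ≤ x c) (c : Column R) : xFix δ α x c ≤ x c := by
  rw [xFix_eq_smul]
  have : 0 ≤ 2 * (α * (1 / δ + 1)) / norm₁ x := div_nonneg (by positivity) (norm₁_nonneg x)
  exact mul_le_of_le_one_left (hx c) (by linarith)

theorem norm₁_xFix (hx : ∀ c, 0 ≤ x c) (hpos : 0 < norm₁ x)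
    (hβ : 2 * (α * (1 / δ + 1)) ≤ norm₁ x) :
    norm₁ (xFix δ α x) = norm₁ x - 2 * (α * (1 / δ + 1)) := by
  rw [xFix_eq_smul, norm₁_smul (sub_nonneg.2 (div_le_one_of_le₀ hβ hpos.le)) hx, sub_mul,
    one_mul, div_mul_cancel₀ _ hpos.ne']

/-- Any solution, scaled down to the share of `x` that is exchanged, covers what `xFix` leaves
uncovered. -/
theorem IsFractional.smul_bVar (hδ : 0 < δ) (hx : IsFractional s R (rhs R) x)
    (hβ : 2 * (α * (1 / δ + 1)) ≤ norm₁ x) {z : Column R →₀ ℝ}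
    (hz : IsFractional s R (rhs R) z) :
    IsFractional s R (bVar δ α x) ((2 * (α * (1 / δ + 1)) / norm₁ x) • z) := by
  have h0 : 0 ≤ 2 * (α * (1 / δ + 1)) / norm₁ x := div_nonneg (by positivity) (norm₁_nonneg x)
  have h1 := div_le_one_of_le₀ hβ (norm₁_nonneg x)
  refine (hz.smul h0).mono fun g => ?_
  rw [bVar, xFix_eq_smul, cover_smul]
  nlinarith [hx.2.2 g]

theorem lin_bVar_le (hδ : 0 < δ) (hx : IsFractional s R (rhs R) x)
    (hβ : 2 * (α * (1 / δ + 1)) ≤ norm₁ x) :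
    lin s R (bVar δ α x) ≤ 2 * (α * (1 / δ + 1)) / norm₁ x * lin s R (rhs R) := by
  set θ := 2 * (α * (1 / δ + 1)) / norm₁ x with hθ
  have h0 : 0 ≤ θ := div_nonneg (by positivity) (norm₁_nonneg x)
  have hle : ∀ z, IsFractional s R (rhs R) z → lin s R (bVar δ α x) ≤ θ * norm₁ z := fun z hz => by
    rw [← norm₁_smul h0 hz.1]
    exact lin_le (hx.smul_bVar hδ hβ hz)
  rcases h0.eq_or_lt with h | h
  · simpa [← h] using hle x hx
  · rw [← div_le_iff₀' h]
    exact le_lin ⟨x, hx⟩ fun z hz => (div_le_iff₀' h).2 (hle z hz)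

/-- The exchange saves `α` as long as `x` is worse than a `(1 + δ)`-approximation, and otherwise
it keeps the value `α` below the one of such an approximation. -/
theorem norm₁_xFix_add_le {δ' : ℝ} (hδ : 0 < δ) (hδ' : 0 ≤ δ')
    (hx : IsFractional s R (rhs R) x) (hpos : 0 < norm₁ x)
    (hβ : 2 * (α * (1 / δ + 1)) ≤ norm₁ x)
    (hlin : norm₁ x = (1 + δ') * lin s R (rhs R)) {xhat : Column R →₀ ℝ}
    (hxhat : IsApproxSolution s R (bVar δ α x) (1 + δ / 2) xhat) :
    norm₁ (xFix δ α x) + norm₁ xhat ≤ max (norm₁ x) ((1 + δ) * lin s R (rhs R)) - α := by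
  set L := lin s R (rhs R) with hL
  set β : ℝ := 2 * (α * (1 / δ + 1)) with hβdef
  have hLpos : 0 < L := by
    by_contra h
    nlinarith
  set v := β / norm₁ x * L with hv
  have hβ0 : 0 ≤ β := by positivity
  have hv0 : 0 ≤ v := by positivity
  have hvβ : v * (1 + δ') = β := by
    rw [hv, hlin]
    field_simp
  have hvL : v ≤ L := mul_le_of_le_one_left hLpos.le (div_le_one_of_le₀ hβ hpos.le)
  have hβα : β * δ = 2 * α * (1 + δ) := by
    rw [hβdef]
    field_simp
  have hhat : norm₁ xhat ≤ (1 + δ / 2) * v :=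
    hxhat.2.trans (mul_le_mul_of_nonneg_left (lin_bVar_le hδ hx hβ) (by positivity))
  rw [norm₁_xFix hx.1 hpos hβ]
  rcases le_total δ δ' with h | h
  · have h1 : (1 + δ) * v ≤ β := by nlinarith
    have h2 : (α : ℝ) ≤ β - (1 + δ / 2) * v := by
      by_contra hcon
      nlinarith
    linarith [le_max_left (norm₁ x) ((1 + δ) * L)]
  · have h1 : β ≤ (1 + δ) * v := by nlinarith
    have h2 : (α : ℝ) ≤ δ / 2 * v := by
      by_contra hcon
      nlinarith
    have h3 : (δ - δ') * v ≤ (δ - δ') * L := mul_le_mul_of_nonneg_left hvL (by linarith)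
    nlinarith [le_max_right (norm₁ x) ((1 + δ) * L)]

theorem norm₁_pos (hx : IsFractional s R (rhs R) x) (hm : 0 < numGroups R) : 0 < norm₁ x := by
  refine (norm₁_nonneg x).lt_of_ne fun h => ?_
  obtain ⟨g⟩ := Fintype.card_pos_iff.1 hm
  have h1 := hx.2.2 g
  rw [eq_zero_of_norm₁_eq_zero h.symm, cover_zero, rhs] at h1
  have h2 : 0 < (members R g.1).card := Finset.card_pos.2 (members_nonempty R g)
  have h3 : (0 : ℝ) < (members R g.1).card := Nat.cast_pos.2 h2
  linarith

/-- Rounding up a basic solution adds at most one bin for each of its components. -/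
theorem opt_le_norm₁_add (hs : ∀ i, 0 < s i) (hx : IsFractional s R (rhs R) x) :
    (opt s : ℝ) ≤ norm₁ x + numGroups R + 1 := by
  obtain ⟨z, hz0, hzsupp, hzcard, hzcover, hznorm⟩ := exists_isReduction hx.1
  have hfrac : IsFractional s R (rhs R) (toReal (z.mapRange Nat.ceil Nat.ceil_zero)) := by
    refine ⟨toReal_nonneg _, fun c hc => hx.2.1 c (hzsupp ?_), fun g => ?_⟩
    · rw [support_toReal] at hc
      exact Finsupp.support_mapRange hc
    · refine (hx.2.2 g).trans ?_
      rw [← hzcover]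
      exact cover_mono (fun c => Nat.le_ceil (z c)) g
  have h1 : (opt s : ℝ) ≤ _ := Nat.cast_le.2 (opt_le_total hs hfrac)
  have h2 := total_ceil_le hz0
  have h3 : (z.support.card : ℝ) ≤ numGroups R + 1 := by exact_mod_cast hzcard
  linarith

end Exchanged

/-! ### The intermediate result of the algorithm -/

/-- What is known before the removal step about the new fractional solution `x'` and the rounded
vector `yhat`: `β` is the norm of the exchanged part of `x`, `D` plus the number of groups bounds the
number of components, and `W` bounds the number of bins of `y` that are given up. -/
structure IsIntermediate (s : I → ℝ) (R : I → Group) (β W : ℝ)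
    (y : Column R →₀ ℕ) (D : ℝ) (x' : Column R →₀ ℝ) (yhat : Column R →₀ ℕ) : Prop where
  fractional : IsFractional s R (rhs R) x'
  le_yhat : ∀ c, x' c ≤ yhat c
  support_eq : yhat.support = x'.support
  card_le : (x'.support.card : ℝ) ≤ D + numGroups R
  total_le : (total yhat : ℝ) ≤ total y + β + numGroups R + 1
  lost_le : (total (y - yhat) : ℝ) ≤ W

section Exchange
variable {δ D : ℝ} {α : ℕ} {x xhat x' : Column R →₀ ℝ} {y yhat : Column R →₀ ℕ}

theorem support_eq_of_le (hx0 : ∀ c, 0 ≤ x c) (hxy : ∀ c, x c ≤ y c)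
    (hcard : x.support.card = y.support.card) : x.support = y.support := by
  refine Finset.eq_of_subset_of_card_le (fun c hc => ?_) hcard.ge
  rw [Finsupp.mem_support_iff] at hc ⊢
  intro h
  have := hxy c
  rw [h, Nat.cast_zero] at this
  exact hc (this.antisymm (hx0 c))

theorem Exchange.exists (hδ : 0 < δ) (hx0 : ∀ c, 0 ≤ x c)
    (hβ : 2 * (α * (1 / δ + 1)) ≤ norm₁ x) (hxhat : ∀ c, 0 ≤ xhat c) :
    ∃ x' yhat, Exchange δ α x y xhat x' yhat := by
  classical
  obtain ⟨a, ha⟩ := exists_isSortedSupport y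
  obtain ⟨l, hl⟩ := exists_isCutoff y a
    (by positivity : (0 : ℝ) ≤ (numGroups R + 2) * (1 / δ + 2))
  obtain ⟨xbar, hxbar⟩ := exists_isReduction
    (z := xhat + (xFix δ α x).filter fun c => c ∈ a.take l) fun c => by
      rw [Finsupp.add_apply, Finsupp.filter_apply]
      refine add_nonneg (hxhat c) ?_
      split_ifs
      exacts [xFix_nonneg hx0 hβ c, le_rfl]
  exact ⟨_, _, a, l, xbar, ha, hl, by convert hxbar, rfl, rfl⟩

theorem Exchange.norm₁_eq (hx0 : ∀ c, 0 ≤ x c) (hβ : 2 * (α * (1 / δ + 1)) ≤ norm₁ x)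
    (hxhat : ∀ c, 0 ≤ xhat c) (h : Exchange δ α x y xhat x' yhat) :
    norm₁ x' = norm₁ (xFix δ α x) + norm₁ xhat := by
  obtain ⟨a, l, xbar, -, -, hxbar, rfl, -⟩ := h
  have hfix : ∀ (p : Column R → Prop) [DecidablePred p] c, 0 ≤ (xFix δ α x).filter p c := by
    intro p _ c
    rw [Finsupp.filter_apply]
    split_ifs
    exacts [xFix_nonneg hx0 hβ c, le_rfl]
  rw [norm₁_add (hfix _) hxbar.1, hxbar.2.2.2.2, norm₁_add hxhat (hfix _), add_left_comm,
    ← norm₁_add (hfix _) (hfix _), add_comm]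
  congr 2
  rw [add_comm]
  exact Finsupp.filter_add_filter_not _ _

/-- The vector `ŷ` is at most `ȳ + ⌈x̄⌉`, where `x̄` has at most `m + 1` components and norm less than
`β` plus the sum of the dropped components of `y`; the latter cancels against `ȳ`. If
`β < ‖x‖`, then only the dropped components of `y` can decrease; otherwise `W` has to bound `‖y‖`. -/
theorem Exchange.isIntermediate {W : ℝ} (hδ : 0 < δ)
    (hx : IsFractional s R (rhs R) x) (hpos : 0 < norm₁ x)
    (hβ : 2 * (α * (1 / δ + 1)) ≤ norm₁ x)
    (hxhat : IsFractional s R (bVar δ α x) xhat)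
    (hlt : norm₁ (xFix δ α x + xhat) < norm₁ x)
    (hy : (numGroups R + 2) * (1 / δ + 2) ≤ (total y : ℝ))
    (hyD : (total y : ℝ) ≤ (D + numGroups R) * (1 / δ + 2))
    (hsupp : x.support = y.support) (hcard : (y.support.card : ℝ) ≤ D + numGroups R)
    (hxy : ∀ c, x c ≤ y c)
    (hW : (numGroups R + 2) * (1 / δ + 2) ≤ W)
    (hW' : norm₁ x = 2 * (α * (1 / δ + 1)) → (total y : ℝ) ≤ W)
    (h : Exchange δ α x y xhat x' yhat) :
    IsIntermediate s R (2 * (α * (1 / δ + 1))) W y D x' yhat := by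
  classical
  obtain ⟨a, l, xbar, ha, hl, hxbar, hx', hyhat⟩ := h
  set β := 2 * (α * (1 / δ + 1)) with hβdef
  have hτ : 0 < 1 / δ + 2 := by positivity
  have hfix0 := xFix_nonneg hx.1 hβ
  have hx'0 : ∀ c, 0 ≤ x' c := fun c => by
    rw [hx', Finsupp.add_apply, Finsupp.filter_apply]
    refine add_nonneg ?_ (hxbar.1 c)
    split_ifs
    exacts [le_rfl, hfix0 c]
  have hfixsupp : (xFix δ α x).support ⊆ x.support := by
    rw [xFix_eq_smul]
    exact Finsupp.support_smul
  have hbarsupp : xbar.support ⊆ xhat.support ∪ x.support := fun c hc => by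
    rcases Finset.mem_union.1 (Finsupp.support_add (hxbar.2.1 hc)) with h | h
    · exact Finset.mem_union_left _ h
    · rw [Finsupp.support_filter] at h
      exact Finset.mem_union_right _ (hfixsupp (Finset.mem_filter.1 h).1)
  have htake : (a.take l).Nodup := ha.1.sublist (List.take_sublist _ _)
  have hyS : total (y.filter (· ∈ a.take l)) = ((a.take l).map y).sum := total_filter_mem htake
  have hySle : (total (y.filter (· ∈ a.take l)) : ℝ) ≤ (numGroups R + 2) * (1 / δ + 2) :=
    hyS ▸ hl.1.2
  have hlen : a.length = y.support.card := by
    rw [← List.toFinset_card_of_nodup ha.1]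
    congr 1
    ext c
    rw [List.mem_toFinset, ha.2.1]
  have hx'c : ∀ c, x' c = (if c ∈ a.take l then 0 else xFix δ α x c) + xbar c := fun c => by
    rw [hx', Finsupp.add_apply, Finsupp.filter_apply]
    by_cases hc : c ∈ a.take l <;> simp [hc]
  have hybarc : ∀ c, yhat c = if x' c = 0 then 0 else
      max ⌈x' c⌉₊ (if c ∈ a.take l then 0 else y c) := fun c => by
    rw [hyhat, roundUp_apply, Finsupp.filter_apply]
    by_cases hc : c ∈ a.take l <;> simp [hc]
  refine ⟨⟨hx'0, fun c hc => ?_, fun g => ?_⟩, fun c => hyhat ▸ le_roundUp _ _ c, ?_, ?_, ?_, ?_⟩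
  · rw [hx'] at hc
    rcases Finset.mem_union.1 (Finsupp.support_add hc) with h | h
    · rw [Finsupp.support_filter] at h
      exact hx.2.1 c (hfixsupp (Finset.mem_filter.1 h).1)
    · rcases Finset.mem_union.1 (hbarsupp h) with h | h
      exacts [hxhat.2.1 c h, hx.2.1 c h]
  · have h1 := hxhat.2.2 g
    rw [bVar] at h1
    have h2 : cover ((xFix δ α x).filter fun c => c ∈ a.take l) g +
        cover ((xFix δ α x).filter fun c => c ∉ a.take l) g = cover (xFix δ α x) g := by
      rw [← cover_add]
      congr 1
      exact Finsupp.filter_add_filter_not _ _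
    have h3 := congrFun hxbar.2.2.2.1 g
    rw [cover_add] at h3
    have h4 : cover x' g = cover ((xFix δ α x).filter fun c => c ∉ a.take l) g + cover xbar g := by
      rw [← cover_add, hx']
    have h5 : cover xbar g =
        cover xhat g + cover ((xFix δ α x).filter fun c => c ∈ a.take l) g := by
      rw [h3]
    linarith
  · ext c
    rw [Finsupp.mem_support_iff, Finsupp.mem_support_iff, hybarc]
    by_cases h : x' c = 0
    · simp [h]
    · have : 0 < ⌈x' c⌉₊ := Nat.ceil_pos.2 ((hx'0 c).lt_of_ne (Ne.symm h))
      rw [if_neg h]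
      simp only [ne_eq, h, not_false_eq_true, iff_true]
      exact (this.trans_le (le_max_left _ _)).ne'
  · have hsub : x'.support ⊆ (y.support \ (a.take l).toFinset) ∪ xbar.support := by
      intro c hc
      rw [Finsupp.mem_support_iff, hx'c] at hc
      by_cases hb : xbar c = 0
      · refine Finset.mem_union_left _ (Finset.mem_sdiff.2 ?_)
        rw [hb, add_zero] at hc
        split_ifs at hc with h
        · exact absurd rfl hc
        · exact ⟨hsupp ▸ hfixsupp (Finsupp.mem_support_iff.2 hc), by simpa using h⟩
      · exact Finset.mem_union_right _ (Finsupp.mem_support_iff.2 hb)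
    have hsdiff : (y.support \ (a.take l).toFinset).card + l = y.support.card := by
      rw [Finset.card_sdiff_of_subset fun c hc =>
        (ha.2.1 c).1 (List.mem_of_mem_take (List.mem_toFinset.1 hc)),
        List.toFinset_card_of_nodup htake, List.length_take, min_eq_left hl.1.1]
      have := hl.1.1
      omega
    have h1 : x'.support.card + l ≤ y.support.card + (numGroups R + 1) := by
      have := (Finset.card_le_card hsub).trans (Finset.card_union_le _ _)
      have := hxbar.2.2.1
      omega
    have h1' : (x'.support.card : ℝ) + l ≤ y.support.card + (numGroups R + 1) := by
      exact_mod_cast h1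
    rcases le_or_gt l (numGroups R) with hlm | hlm
    · have h2 := (hl.card_sub_le hτ.le ha hlm hy).trans hyD
      have h3 := le_of_mul_le_mul_right h2 hτ
      rw [hlen] at h3
      linarith
    · have : (numGroups R : ℝ) + 1 ≤ l := by exact_mod_cast hlm
      linarith
  · have hle : yhat ≤ y.filter (· ∉ a.take l) + xbar.mapRange Nat.ceil Nat.ceil_zero := by
      intro c
      rw [hybarc, Finsupp.add_apply, Finsupp.filter_apply, Finsupp.mapRange_apply]
      split_ifs with h1 h2 h3
      · exact Nat.zero_le _
      · exact Nat.zero_le _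
      · rw [hx'c, if_pos h3]
        simp
      · refine max_le (Nat.ceil_le.2 ?_) (Nat.le_add_right _ _)
        rw [hx'c, if_neg h3]
        push_cast
        exact add_le_add ((xFix_le hδ hx.1 c).trans (hxy c)) (Nat.le_ceil _)
    have h1 : (total yhat : ℝ) ≤ _ := Nat.cast_le.2 (total_mono hle)
    rw [total_add, Nat.cast_add] at h1
    have h2 := total_ceil_le hxbar.1
    have h3 : (xbar.support.card : ℝ) ≤ numGroups R + 1 := by exact_mod_cast hxbar.2.2.1
    have hfilt0 : ∀ c, 0 ≤ (xFix δ α x).filter (· ∈ a.take l) c := fun c => by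
      rw [Finsupp.filter_apply]
      split_ifs
      exacts [hfix0 c, le_rfl]
    have h4 : norm₁ xbar = norm₁ xhat + norm₁ ((xFix δ α x).filter (· ∈ a.take l)) := by
      rw [hxbar.2.2.2.2, ← norm₁_add hxhat.1 hfilt0]
    have h5 : norm₁ ((xFix δ α x).filter (· ∈ a.take l)) ≤ total (y.filter (· ∈ a.take l)) := by
      rw [← norm₁_toReal]
      refine norm₁_mono hfilt0 fun c => ?_
      rw [toReal_apply, Finsupp.filter_apply, Finsupp.filter_apply]
      split_ifs
      · exact (xFix_le hδ hx.1 c).trans (hxy c)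
      · simp
    have h6 : (total (y.filter (· ∈ a.take l)) : ℝ) + total (y.filter (· ∉ a.take l)) =
        total y := by
      rw [← Nat.cast_add, ← total_add]
      congr 2
      exact Finsupp.filter_add_filter_not _ _
    rw [norm₁_add hfix0 hxhat.1, norm₁_xFix hx.1 hpos hβ] at hlt
    linarith
  · rcases hβ.eq_or_lt with heq | hlt'
    · exact (Nat.cast_le.2 (total_mono tsub_le_self)).trans (hW' heq.symm)
    · refine le_trans (Nat.cast_le.2 (total_mono ?_)) (hySle.trans hW)
      intro c
      rw [Finsupp.coe_tsub, Pi.sub_apply, Finsupp.filter_apply]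
      split_ifs with hc
      · exact Nat.sub_le _ _
      · rw [Nat.le_zero, Nat.sub_eq_zero_iff_le]
        by_cases hyc : y c = 0
        · rw [hyc]
          exact Nat.zero_le _
        -- a component outside `S` remains nonzero, since `xFix` is a positive multiple of `x`
        have hxc : 0 < x c := (hx.1 c).lt_of_ne' (Finsupp.mem_support_iff.1
          (hsupp ▸ Finsupp.mem_support_iff.2 hyc))
        have hfixc : 0 < xFix δ α x c := by
          rw [xFix_eq_smul]
          exact mul_pos (sub_pos.2 ((div_lt_one hpos).2 hlt')) hxc
        have hx'pos : x' c ≠ 0 := by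
          rw [hx'c, if_neg hc]
          exact (add_pos_of_pos_of_nonneg hfixc (hxbar.1 c)).ne'
        rw [hybarc, if_neg hx'pos, if_neg hc]
        exact le_max_right _ _

end Exchange

/-! ### The removal step and the repacking -/

section Removal
variable {β W D E t : ℝ} {α : ℕ} {x' : Column R →₀ ℝ} {y yhat d : Column R →₀ ℕ}

theorem IsIntermediate.sub_nonneg (h : IsIntermediate s R β W y D x' yhat) (c : Column R) :
    0 ≤ (toReal yhat - x') c := by
  rw [Finsupp.sub_apply, toReal_apply]
  linarith [h.le_yhat c]

theorem IsIntermediate.removed_le (h : IsIntermediate s R β W y D x' yhat)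
    (hd : IsRemoval (toReal yhat - x') t d) : d ≤ yhat := fun c => by
  have h1 := hd.1 c
  rw [Finsupp.sub_apply, toReal_apply] at h1
  exact_mod_cast (by linarith [h.fractional.1 c] : (d c : ℝ) ≤ yhat c)

theorem IsIntermediate.cast_sub_apply (h : IsIntermediate s R β W y D x' yhat)
    (hd : IsRemoval (toReal yhat - x') t d) (c : Column R) :
    (((yhat - d) c : ℕ) : ℝ) = yhat c - d c := by
  rw [Finsupp.coe_tsub, Pi.sub_apply, Nat.cast_sub (h.removed_le hd c)]

theorem IsIntermediate.le_sub (h : IsIntermediate s R β W y D x' yhat)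
    (hd : IsRemoval (toReal yhat - x') t d) (c : Column R) : x' c ≤ ((yhat - d) c : ℕ) := by
  rw [h.cast_sub_apply hd]
  have h1 := hd.1 c
  rw [Finsupp.sub_apply, toReal_apply] at h1
  linarith

theorem IsIntermediate.support_sub (h : IsIntermediate s R β W y D x' yhat)
    (hd : IsRemoval (toReal yhat - x') t d) : x'.support = (yhat - d).support := by
  ext c
  constructor
  · intro hc
    have h1 : 0 < x' c := (h.fractional.1 c).lt_of_ne' (Finsupp.mem_support_iff.1 hc)
    have h2 := h1.trans_le (h.le_sub hd c)
    exact Finsupp.mem_support_iff.2 (Nat.cast_pos.1 h2).ne'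
  · intro hc
    rw [← h.support_eq]
    rw [Finsupp.mem_support_iff, Finsupp.coe_tsub, Pi.sub_apply] at hc
    exact Finsupp.mem_support_iff.2 (by omega)

theorem IsIntermediate.isFractional_sub (h : IsIntermediate s R β W y D x' yhat)
    (hd : IsRemoval (toReal yhat - x') t d) :
    IsFractional s R (rhs R) (toReal (yhat - d)) := by
  refine ⟨toReal_nonneg _, fun c hc => h.fractional.2.1 c ?_, fun g =>
    (h.fractional.2.2 g).trans (cover_mono (h.le_sub hd) g)⟩
  rwa [support_toReal, ← h.support_sub hd] at hc

/-- If the removed vector is large, then `α` bins are saved compared to `y`; otherwise, the result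
is `x'` rounded up. -/
theorem IsIntermediate.total_sub_le (h : IsIntermediate s R β W y D x' yhat)
    (ht : t = β + (numGroups R + 1) + α) (hβ : 0 ≤ β)
    (hd : IsRemoval (toReal yhat - x') t d) (hx' : norm₁ x' ≤ E - α)
    (hy : (total y : ℝ) ≤ E + D + numGroups R) :
    (total (yhat - d) : ℝ) ≤ E + D + numGroups R - α := by
  rcases hd.lt_total_or h.sub_nonneg (by rw [ht]; positivity) with hlt | hall
  · have h1 : (total (yhat - d) : ℝ) + total d = total yhat := by
      rw [← Nat.cast_add, ← total_add, tsub_add_cancel_of_le (h.removed_le hd)]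
    have h2 : (total (yhat - d) : ℝ) + α < total y + 1 := by linarith [h.total_le]
    have h3 : total (yhat - d) + α ≤ total y := Nat.lt_succ_iff.1 (by exact_mod_cast h2)
    have h4 : (total (yhat - d) : ℝ) + α ≤ total y := by exact_mod_cast h3
    linarith
  · have h1 := total_le_norm₁_add_card h.fractional.1 (h.support_sub hd).ge fun c => by
      rw [h.cast_sub_apply hd]
      have := hall c
      rw [Finsupp.sub_apply, toReal_apply] at this
      linarith
    linarith [h.card_le]

theorem IsIntermediate.total_lost_le (h : IsIntermediate s R β W y D x' yhat)
    (hd : IsRemoval (toReal yhat - x') t d) : (total (y - (yhat - d)) : ℝ) ≤ W + t := by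
  have hle : y - (yhat - d) ≤ (y - yhat) + d := by
    intro c
    simp only [Finsupp.coe_tsub, Pi.sub_apply, Finsupp.add_apply]
    omega
  have h1 : (total (y - (yhat - d)) : ℝ) ≤ _ := Nat.cast_le.2 (total_mono hle)
  rw [total_add, Nat.cast_add] at h1
  linarith [h.lost_le, hd.total_le]

/-- With `y' = yhat - d`, the number of changed bins is at most `|‖y‖ - ‖y'‖|`, plus the number
`W + t` of bins given up, plus the two bins that are exchanged. -/
theorem IsIntermediate.exists_corresponds [Nonempty I] (hs : ∀ i, 0 < s i)
    (h : IsIntermediate s R β W y D x' yhat) (hβ : 0 ≤ β)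
    (hd : IsRemoval (toReal yhat - x') t d) {B : I → ℕ} {conf : ℕ → Column R}
    (hB : Corresponds s R y B conf) :
    ∃ B' conf', Corresponds s R (yhat - d) B' conf' ∧ maxBin B' = total (yhat - d) ∧
      ((changedBins (total y) B conf (total (yhat - d)) B' conf').card : ℝ) ≤
        β + numGroups R + 1 + 2 * (W + t) + 2 := by
  obtain ⟨B', conf', hB', hmax, hcard⟩ :=
    exists_corresponds_card_changedBins_le hs hB (h.isFractional_sub hd)
  refine ⟨B', conf', hB', hmax, ?_⟩
  have h1 : (((changedBins (total y) B conf (total (yhat - d)) B' conf').card : ℕ) : ℝ) ≤ _ :=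
    Nat.cast_le.2 hcard
  have h2 := h.total_lost_le hd
  have h3 : (total (yhat - d) : ℝ) ≤ total yhat := Nat.cast_le.2 (total_mono tsub_le_self)
  have h4 : total y ≤ total (yhat - d) + total (y - (yhat - d)) := by
    rw [← total_add]
    exact total_mono le_add_tsub
  have h5 : ((max (total y) (total (yhat - d)) - min (total y) (total (yhat - d)) : ℕ) : ℝ) ≤
      β + numGroups R + 1 + total (y - (yhat - d)) := by
    rcases le_total (total y) (total (yhat - d)) with hle | hle
    · rw [max_eq_right hle, min_eq_left hle, Nat.cast_sub hle]
      have : (0 : ℝ) ≤ total (y - (yhat - d)) := Nat.cast_nonneg _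
      linarith [h.total_le]
    · rw [max_eq_left hle, min_eq_right hle]
      have h6 : ((total y - total (yhat - d) : ℕ) : ℝ) ≤ total (y - (yhat - d)) :=
        Nat.cast_le.2 (by omega)
      have : (0 : ℝ) ≤ numGroups R := Nat.cast_nonneg _
      linarith
  push_cast at h1
  linarith

end Removal

theorem opt_eq_zero_of_isEmpty {I : Type*} [Fintype I] [IsEmpty I] (s : I → ℝ) : opt s = 0 :=
  Nat.le_zero.1 (Nat.sInf_le ⟨isEmptyElim, isEmptyElim, fun j => by simp⟩)

theorem numGroups_pos {I : Type*} [Fintype I] [Nonempty I] (R : I → Group) : 0 < numGroups R := by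
  obtain ⟨i⟩ := ‹Nonempty I›
  exact Fintype.card_pos_iff.2 ⟨⟨R i, Finset.mem_image_of_mem R (Finset.mem_univ i)⟩⟩

/-- The bound for the changed bins in the form `O((m + α) / δ)`: growth by `β + m + 1` bins, twice
the bins lost with dropped components, those of `y` in case all of `x` is exchanged, and the removed
ones, and two exchanged bins. -/
theorem changed_bound {m α δ : ℝ} (hm : 1 ≤ m) (hα : 0 ≤ α) (hδ : 0 < δ) (hδ1 : δ ≤ 1) :
    2 * (α * (1 / δ + 1)) + m + 1 + 2 * (((m + 2) * (1 / δ + 2) +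
      (7 * (2 * (α * (1 / δ + 1)) + m + 1) + m)) +
      (2 * (α * (1 / δ + 1)) + (m + 1) + α)) + 2 ≤ 100 * ((m + α) / δ) := by
  have hinv : 1 ≤ 1 / δ := (one_le_div hδ).2 hδ1
  rw [div_eq_mul_one_div (m + α) δ]
  set u := 1 / δ
  nlinarith [mul_nonneg hα (sub_nonneg.2 hinv),
    mul_nonneg (sub_nonneg.2 hm) (sub_nonneg.2 hinv)]

end DynamicBinPacking

open DynamicBinPacking in
theorem mainTheorem7 :
    ∃ K : ℝ, ∀ (I : Type*) [Fintype I] (s : I → ℝ) (ε δ δ' Δ C : ℝ) (α : ℕ)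
      (R : I → DynamicBinPacking.Group)
      (x : DynamicBinPacking.Column R →₀ ℝ) (y : DynamicBinPacking.Column R →₀ ℕ)
      (B : I → ℕ) (conf : ℕ → DynamicBinPacking.Column R),
      0 < ε → ε ≤ 1 → 0 < δ → δ ≤ 1 → 0 < δ' →
      Δ = ε + δ + ε * δ →
      C = Δ * DynamicBinPacking.opt s + DynamicBinPacking.numGroups R →
      -- a large-item instance with a rounding function
      (∀ i, ε / 14 ≤ s i ∧ s i ≤ 1) →
      DynamicBinPacking.IsRounding s (DynamicBinPacking.groupParam s ε) R →
      -- the fractional solution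
      DynamicBinPacking.IsFractional s R (DynamicBinPacking.rhs R) x →
      DynamicBinPacking.norm₁ x ≤ (1 + Δ) * DynamicBinPacking.opt s →
      2 * α * (1 / δ + 1) ≤ DynamicBinPacking.norm₁ x →
      DynamicBinPacking.norm₁ x =
        (1 + δ') * DynamicBinPacking.lin s R (DynamicBinPacking.rhs R) →
      -- the integral solution and its packing
      DynamicBinPacking.IsFractional s R (DynamicBinPacking.rhs R)
        (DynamicBinPacking.toReal y) →
      (DynamicBinPacking.numGroups R + 2) * (1 / δ + 2) ≤ (DynamicBinPacking.total y : ℝ) →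
      DynamicBinPacking.Corresponds s R y B conf →
      DynamicBinPacking.maxBin B = DynamicBinPacking.total y →
      (DynamicBinPacking.total y : ℝ) ≤
        (1 + 2 * Δ) * DynamicBinPacking.opt s + DynamicBinPacking.numGroups R →
      -- the component conditions
      x.support.card = y.support.card →
      (y.support.card : ℝ) ≤ C →
      (∀ c, x c ≤ y c) →
      -- the algorithm has an output, and every output is as claimed
      (∃ x' y', DynamicBinPacking.ImproveReturns s R δ α x y x' y') ∧
      ∀ x' y', DynamicBinPacking.ImproveReturns s R δ α x y x' y' →
        DynamicBinPacking.IsFractional s R (DynamicBinPacking.rhs R) x' ∧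
        DynamicBinPacking.norm₁ x' ≤ (1 + Δ) * DynamicBinPacking.opt s - α ∧
        DynamicBinPacking.IsFractional s R (DynamicBinPacking.rhs R)
          (DynamicBinPacking.toReal y') ∧
        x'.support.card = y'.support.card ∧
        (y'.support.card : ℝ) ≤ C ∧
        (∀ c, x' c ≤ y' c) ∧
        ∃ (B' : I → ℕ) (conf' : ℕ → DynamicBinPacking.Column R),
          DynamicBinPacking.Corresponds s R y' B' conf' ∧
          DynamicBinPacking.maxBin B' = DynamicBinPacking.total y' ∧
          (DynamicBinPacking.total y' : ℝ) ≤
            (1 + 2 * Δ) * DynamicBinPacking.opt s + DynamicBinPacking.numGroups R - α ∧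
          ((DynamicBinPacking.changedBins (DynamicBinPacking.total y) B conf
              (DynamicBinPacking.total y') B' conf').card : ℝ) ≤
            K * ((DynamicBinPacking.numGroups R + α) / δ) ∧
          ((DynamicBinPacking.changedBins (DynamicBinPacking.total y) B conf
              (DynamicBinPacking.total y') B' conf').card : ℝ) ≤
            K * (1 + α) * (DynamicBinPacking.numGroups R / δ) := by
  refine ⟨100, ?_⟩
  intro I _ s ε δ δ' Δ C α R x y B conf hε hε1 hδ hδ1 hδ' hΔ hC hs hR hx hxn hxβ hxlin hy hyt hB _
    hyn hcard hyC hxy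
  have hpos : ∀ i, 0 < s i := fun i => (by positivity : 0 < ε / 14).trans_le (hs i).1
  have hΔδ : δ ≤ Δ := by rw [hΔ]; nlinarith
  have hΔ3 : Δ ≤ 3 := by rw [hΔ]; nlinarith
  -- without items, `C = 0` forces `y = 0`, against the lower bound for its norm
  have hne : Nonempty I := by
    by_contra hI
    rw [not_nonempty_iff] at hI
    have hm0 : numGroups R = 0 := Fintype.card_eq_zero_iff.2 ⟨fun g => by
      obtain ⟨i, -⟩ := members_nonempty R g
      exact isEmptyElim i⟩
    have hC0 : C = 0 := by rw [hC, opt_eq_zero_of_isEmpty, hm0]; simp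
    have hy0 : y = 0 := by
      rw [← Finsupp.card_support_eq_zero]
      exact_mod_cast (hyC.trans hC0.le).antisymm (Nat.cast_nonneg _)
    have : (0 : ℝ) < (numGroups R + 2) * (1 / δ + 2) := by positivity
    rw [hy0] at hyt
    simp only [total, Finsupp.sum_zero_index, Nat.cast_zero] at hyt
    linarith
  have hm := numGroups_pos R
  have hm1 : (1 : ℝ) ≤ numGroups R := by exact_mod_cast hm
  have hα0 : (0 : ℝ) ≤ α := Nat.cast_nonneg _
  have hxpos := norm₁_pos hx hm
  have hβ : 2 * (α * (1 / δ + 1)) ≤ norm₁ x := by linarith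
  have hβ0 : 0 ≤ 2 * ((α : ℝ) * (1 / δ + 1)) := by positivity
  have hopt0 : (0 : ℝ) ≤ opt s := Nat.cast_nonneg _
  have hsupp := support_eq_of_le hx.1 hxy hcard
  set β : ℝ := 2 * (α * (1 / δ + 1)) with hβdef
  set D := Δ * opt s with hD
  set E := (1 + Δ) * opt s with hE
  have hED : (1 + 2 * Δ) * opt s + numGroups R = E + D + numGroups R := by rw [hE, hD]; ring
  set W : ℝ := (numGroups R + 2) * (1 / δ + 2) + (7 * (β + numGroups R + 1) + numGroups R)
    with hW
  have hyD : (total y : ℝ) ≤ (D + numGroups R) * (1 / δ + 2) := by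
    have h1 : (opt s : ℝ) ≤ D * (1 / δ) := by
      rw [hD, mul_one_div, le_div_iff₀ hδ]
      nlinarith
    have h2 : (numGroups R : ℝ) ≤ numGroups R * (1 / δ + 2) := by
      have : 0 < 1 / δ := by positivity
      nlinarith
    nlinarith
  -- if the whole of `x` is exchanged, then `OPT`, and with it `y`, is small
  have hW' : norm₁ x = β → (total y : ℝ) ≤ W := fun heq => by
    have h1 := opt_le_norm₁_add hpos hx
    rw [heq] at h1
    have h2 : (1 + 2 * Δ) * opt s ≤ 7 * opt s :=
      mul_le_mul_of_nonneg_right (by linarith) hopt0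
    have h3 : (0 : ℝ) ≤ (numGroups R + 2) * (1 / δ + 2) := by positivity
    linarith
  have hW0 : (numGroups R + 2) * (1 / δ + 2) ≤ W := by
    rw [hW]
    linarith
  have hlin : max (norm₁ x) ((1 + δ) * lin s R (rhs R)) ≤ E := by
    refine max_le hxn ?_
    have h1 := lin_rhs_le hε hε1 (fun i => (hs i).1) (fun i => (hs i).2) hR
    have h2 := mul_le_mul_of_nonneg_left h1 (by positivity : 0 ≤ 1 + δ)
    rw [hE, hΔ]
    linarith
  have hint : ∀ xhat x' yhat, IsApproxSolution s R (bVar δ α x) (1 + δ / 2) xhat →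
      ((norm₁ x ≤ norm₁ (xFix δ α x + xhat) ∧ x' = x ∧ yhat = y) ∨
        (norm₁ (xFix δ α x + xhat) < norm₁ x ∧ Exchange δ α x y xhat x' yhat)) →
      norm₁ x' ≤ E - α ∧ IsIntermediate s R β W y D x' yhat := by
    intro xhat x' yhat hxhat hcases
    have h1 := norm₁_xFix_add_le hδ hδ'.le hx hxpos hβ hxlin hxhat
    rcases hcases with ⟨hle, rfl, rfl⟩ | ⟨hlt, hex⟩
    · rw [norm₁_add (xFix_nonneg hx.1 hβ) hxhat.1.1] at hle
      refine ⟨by linarith, hx, hxy, hsupp.symm, ?_, by linarith, ?_⟩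
      · rw [hcard, ← hC]
        exact hyC
      · rw [tsub_self]
        have h3 : (0 : ℝ) ≤ (numGroups R + 2) * (1 / δ + 2) := by positivity
        simpa [total] using h3.trans hW0
    · refine ⟨?_, hex.isIntermediate hδ hx hxpos hβ hxhat.1 hlt hyt hyD hsupp (hC ▸ hyC) hxy hW0
        hW'⟩
      rw [hex.norm₁_eq hx.1 hβ hxhat.1.1]
      linarith
  have ht : 0 < removalAmount (numGroups R) δ α := by
    rw [removalAmount]
    positivity
  constructor
  · obtain ⟨xhat, hxhat⟩ := exists_isApproxSolution hpos (by linarith : 1 < 1 + δ / 2)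
      ⟨_, hx.smul_bVar hδ hβ hx⟩
    obtain ⟨x', yhat, hcases⟩ : ∃ x' yhat,
        ((norm₁ x ≤ norm₁ (xFix δ α x + xhat) ∧ x' = x ∧ yhat = y) ∨
        (norm₁ (xFix δ α x + xhat) < norm₁ x ∧ Exchange δ α x y xhat x' yhat)) := by
      rcases le_or_gt (norm₁ x) (norm₁ (xFix δ α x + xhat)) with hle | hlt
      · exact ⟨x, y, Or.inl ⟨hle, rfl, rfl⟩⟩
      · obtain ⟨x', yhat, hex⟩ := Exchange.exists (y := y) hδ hx.1 hβ hxhat.1.1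
        exact ⟨x', yhat, Or.inr ⟨hlt, hex⟩⟩
    obtain ⟨-, hi⟩ := hint xhat x' yhat hxhat hcases
    obtain ⟨d, hd⟩ := exists_isRemoval hi.sub_nonneg ht
    exact ⟨x', _, xhat, yhat, d, hxhat, hcases, hd, rfl⟩
  · rintro x' y' ⟨xhat, yhat, d, hxhat, hcases, hd, rfl⟩
    obtain ⟨hx'n, hi⟩ := hint xhat x' yhat hxhat hcases
    obtain ⟨B', conf', hB', hmax, hch⟩ := hi.exists_corresponds hpos hβ0 hd hB
    have hbound := changed_bound hm1 hα0 hδ hδ1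
    have hfirst : ((changedBins (total y) B conf (total (yhat - d)) B' conf').card : ℝ) ≤
        100 * ((numGroups R + α) / δ) := hch.trans hbound
    refine ⟨hi.fractional, hx'n, hi.isFractional_sub hd, by rw [hi.support_sub hd], ?_,
      hi.le_sub hd, B', conf', hB', hmax, ?_, hfirst, hfirst.trans ?_⟩
    · rw [← hi.support_sub hd, hC]
      exact hi.card_le
    · rw [hED]
      exact hi.total_sub_le rfl hβ0 hd hx'n (hED ▸ hyn)
    · have h1 : (numGroups R + α : ℝ) ≤ (1 + α) * numGroups R := by nlinarith
      have h2 := div_le_div_of_nonneg_right h1 hδ.le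
      rw [mul_div_assoc] at h2
      rw [mul_assoc]
      linarith
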